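/- Let $K$ be a number field and let $|\cdot|_w$ be its normalized absolute values (for $w$ complex, $|\cdot|_w$ is the square of the modulus; for $w$ finite, $|a|_w=N(w)^{-\mathrm{ord}_w(a)}$). An adelically normed $K$-vector space is a finite dimensional $K$-vector space $V$ with a finitely generated $\mathcal O_K$-submodule $\Lambda$ spanning $V$ over $K$ and, for every archimedean place $w$, a norm on $V_w=V\otimes_K K_w$, given by $\|y\|_w=\sqrt{\varphi_w(y,y)}$ for a euclidean scalar product $\varphi_w$ if $w$ is real and by $\|y\|_w=\varphi_w(y,y)$ for a positive definite hermitian form $\varphi_w$ if $w$ is complex; for $w$ finite, $\|\cdot\|_w$ is the norm defined by the localization of $\Lambda$ at $w$. Subspaces $F\subset V$ (with $\Lambda\cap F$), quotients, exterior powers, and tensor products with the dual of a line carry induced structures. The arithmetic degree is $\widehat{\deg}(V)=-\sum_w\log\|y\|_w$ for any nonzero $y\in\bigwedge^{\dim V}V$. Let $m_V(x)=\max\{y\in\mathbb R\mid (x,y)\in\mathcal P(V)\}$, where $\mathcal P(V)$ is the convex hull in $\mathbb R^2$ of the points $(\dim F,\widehat{\deg}(F))$ for $F$ a subspace of $V$;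 the slopes of $V$ are $\mu_i(V)=m_V(i)-m_V(i-1)$ for $1\le i\le\dim V$. Let $n\ge 0$ and let $E=K^{n+1}$, with $\Lambda=\mathcal O_K^{n+1}$ and the standard euclidean or hermitian form $\sum_i\overline{x_i}y_i$ at each archimedean place. For $P\in\mathbb P^n(K)=\mathbb P(E)(K)$, let $D\subset E$ be the corresponding line, and equip the tangent space $T_P\mathbb P^n=(D^\vee\otimes E)/(D^\vee\otimes D)$ with the quotient adelic norm. Put $h(P)=\widehat{\deg}(T_P\mathbb P^n)$ (the logarithmic anticanonical height), and define the freeness of $P$ by $l(P)=n\,\mu_n(T_P\mathbb P^n)/h(P)$ if $\mu_n(T_P\mathbb P^n)>0$ and $l(P)=0$ otherwise. Proposition and Corollary. Let $P\in\mathbb P^n(K)$ be such that $h(P)\neq 0$. Then $$l(P)=\frac n{n+1}+\min_F\left(\frac{-n\,\widehat{\deg}(F)}{\operatorname{codim}_E(F)\,h(P)}\right),$$ where $F$ runs over the subspaces $F\subsetneq E$ with $P\in\mathbb P(F)$, that is $D\subset F$; in particular the minimum exists. Consequently $$l(P)\ge\frac n{n+1}.$$ -/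

import Mathlib

open scoped NumberField TensorProduct LinearAlgebra.Projectivization
open NumberField NumberField.InfinitePlace IsDedekindDomain

noncomputable section

namespace Arakelov

/-! ### The archimedean completions of a number field as `RCLike` fields -/

section Archimedean

variable {K : Type*} [Field K] (w : InfinitePlace K)

/-- The canonical embedding `K_w → ℂ`. -/
abbrev emb : w.Completion →+* ℂ := Completion.extensionEmbedding w

theorem norm_emb (z : w.Completion) : ‖emb w z‖ = ‖z‖ :=
  (Completion.isometry_extensionEmbedding w).norm_map_of_map_zero (map_zero _) z

theorem exists_real (r : ℝ) : ∃ z : w.Completion, emb w z = r := by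
  rcases w.isReal_or_isComplex with h | h
  · obtain ⟨z, hz⟩ := Completion.surjective_extensionEmbeddingOfIsReal h r
    exact ⟨z, by rw [emb, ← Completion.extensionEmbeddingOfIsReal_apply h, hz]⟩
  · exact Completion.surjective_extensionEmbedding_of_isComplex h _

theorem exists_conj (z : w.Completion) :
    ∃ z' : w.Completion, emb w z' = (starRingEnd ℂ) (emb w z) := by
  rcases w.isReal_or_isComplex with h | h
  · exact ⟨z, by
      rw [emb, ← Completion.extensionEmbeddingOfIsReal_apply h, Complex.conj_ofReal]⟩
  · exact Completion.surjective_extensionEmbedding_of_isComplex h _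

/-- The inclusion `ℝ → K_w`. -/
def ofRealHom : ℝ →+* w.Completion where
  toFun r := (exists_real w r).choose
  map_zero' := (emb w).injective (by rw [(exists_real w _).choose_spec]; simp)
  map_one' := (emb w).injective (by rw [(exists_real w _).choose_spec]; simp)
  map_add' x y := (emb w).injective (by
    rw [map_add]; simp only [(exists_real w _).choose_spec]; simp)
  map_mul' x y := (emb w).injective (by
    rw [map_mul]; simp only [(exists_real w _).choose_spec]; simp)

theorem emb_ofRealHom (r : ℝ) : emb w (ofRealHom w r) = r := (exists_real w r).choose_spec

/-- The conjugation of `K_w`. -/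
def conjFun (z : w.Completion) : w.Completion := (exists_conj w z).choose

theorem emb_conjFun (z : w.Completion) : emb w (conjFun w z) = (starRingEnd ℂ) (emb w z) :=
  (exists_conj w z).choose_spec

instance : StarRing w.Completion where
  star := conjFun w
  star_involutive z := (emb w).injective (by simp [emb_conjFun])
  star_mul x y := (emb w).injective (by simp [emb_conjFun, mul_comm])
  star_add x y := (emb w).injective (by simp [emb_conjFun])

theorem emb_star (z : w.Completion) : emb w (star z) = (starRingEnd ℂ) (emb w z) :=
  emb_conjFun w z

instance : NormedAlgebra ℝ w.Completion where
  __ := (ofRealHom w).toAlgebra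
  norm_smul_le r x := by
    change ‖ofRealHom w r * x‖ ≤ _
    rw [norm_mul, ← norm_emb, emb_ofRealHom, Complex.norm_real]

theorem emb_algebraMap (r : ℝ) : emb w (algebraMap ℝ w.Completion r) = r := emb_ofRealHom w r

open Classical in
/-- A square root of `-1` in `K_w`, or `0` if `w` is real. -/
def sqrtNegOne : w.Completion :=
  if h : ∃ z : w.Completion, emb w z = Complex.I then h.choose else 0

theorem emb_im_of_not (h : ¬ ∃ z : w.Completion, emb w z = Complex.I) (z : w.Completion) :
    (emb w z).im = 0 := by
  rcases w.isReal_or_isComplex with hw | hw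
  · rw [emb, ← Completion.extensionEmbeddingOfIsReal_apply hw, Complex.ofReal_im]
  · exact absurd (Completion.surjective_extensionEmbedding_of_isComplex hw _) h

theorem emb_sqrtNegOne : (emb w (sqrtNegOne w) = Complex.I) ∨
    (sqrtNegOne w = 0 ∧ ∀ z, (emb w z).im = 0) := by
  unfold sqrtNegOne
  split_ifs with h
  · exact Or.inl h.choose_spec
  · exact Or.inr ⟨rfl, emb_im_of_not w h⟩

open Classical in
/-- The completion `K_w` at an archimedean place, with the real and imaginary parts and the
conjugation induced by `K_w ⊆ ℂ` (the trivial conjugation if `w` is real). -/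
abbrev completionRCLike : RCLike w.Completion where
  lt_norm_lt x y hx hxy := by
    obtain ⟨r, hr⟩ := exists_between hxy
    refine ⟨ofRealHom w r, ?_⟩
    rw [← norm_emb, emb_ofRealHom, Complex.norm_real, Real.norm_of_nonneg (hx.trans hr.1.le)]
    exact hr
  re := { toFun := fun z => (emb w z).re, map_zero' := by simp, map_add' := by simp }
  im := { toFun := fun z => (emb w z).im, map_zero' := by simp, map_add' := by simp }
  I := sqrtNegOne w
  I_re_ax := by
    rcases emb_sqrtNegOne w with h | ⟨h, -⟩
    · change (emb w _).re = 0
      rw [h]; simp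
    · change (emb w _).re = 0
      rw [h]; simp
  I_mul_I_ax := by
    rcases emb_sqrtNegOne w with h | ⟨h, -⟩
    · exact Or.inr ((emb w).injective (by rw [map_mul, h]; simp))
    · exact Or.inl h
  re_add_im_ax z := (emb w).injective (by
    rw [map_add, map_mul, emb_algebraMap, emb_algebraMap]
    change ((emb w z).re : ℂ) + ((emb w z).im : ℂ) * _ = _
    rcases emb_sqrtNegOne w with h | ⟨h, h'⟩
    · rw [h, Complex.re_add_im]
    · rw [h' z, h]
      apply Complex.ext <;> simp [h' z])
  ofReal_re_ax r := by
    change (emb w _).re = r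
    rw [emb_algebraMap, Complex.ofReal_re]
  ofReal_im_ax r := by
    change (emb w _).im = 0
    rw [emb_algebraMap, Complex.ofReal_im]
  mul_re_ax z z' := by
    change (emb w _).re = (emb w _).re * (emb w _).re - (emb w _).im * (emb w _).im
    rw [map_mul, Complex.mul_re]
  mul_im_ax z z' := by
    change (emb w _).im = (emb w _).re * (emb w _).im + (emb w _).im * (emb w _).re
    rw [map_mul, Complex.mul_im]
  conj_re_ax z := by
    change (emb w (star z)).re = (emb w z).re
    rw [emb_star, Complex.conj_re]
  conj_im_ax z := by
    change (emb w (star z)).im = -(emb w z).im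
    rw [emb_star, Complex.conj_im]
  conj_I_ax := (emb w).injective (by
    change emb w (star _) = _
    rw [emb_star, map_neg]
    rcases emb_sqrtNegOne w with h | ⟨h, -⟩
    · rw [h, Complex.conj_I]
    · rw [h]; simp)
  norm_sq_eq_def_ax z := by
    change _ = (emb w _).re * (emb w _).re + (emb w _).im * (emb w _).im
    rw [← norm_emb, Complex.sq_norm, Complex.normSq_apply]
  mul_im_I_ax z := by
    change (emb w _).im * (emb w _).im = (emb w _).im
    rcases emb_sqrtNegOne w with h | ⟨-, h⟩
    · rw [h]; simp
    · rw [h z]; simp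
  toPartialOrder :=
    { le := fun z z' => (emb w z).re ≤ (emb w z').re ∧ (emb w z).im = (emb w z').im
      le_refl := fun z => ⟨le_rfl, rfl⟩
      le_trans := fun _ _ _ h h' => ⟨h.1.trans h'.1, h.2.trans h'.2⟩
      le_antisymm := fun _ _ h h' =>
        (emb w).injective (Complex.ext (le_antisymm h.1 h'.1) h.2) }
  le_iff_re_im := Iff.rfl

/-- A positive definite hermitian form on a `K_w`-vector space (a euclidean scalar product if `w`
is real), conjugate linear in the first variable. -/
abbrev HermForm (V : Type*) [AddCommGroup V] [Module w.Completion V] :=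
  letI := completionRCLike w
  InnerProductSpace.Core w.Completion V

end Archimedean

/-! ### Positive definite hermitian forms: pull-back and quotient -/

section Forms

variable {𝕜 V W : Type*} [RCLike 𝕜] [AddCommGroup V] [Module 𝕜 V] [AddCommGroup W] [Module 𝕜 W]

/-- The pull-back of a positive definite hermitian form along an injective linear map. -/
abbrev pullback (c : InnerProductSpace.Core 𝕜 V) (f : W →ₗ[𝕜] V)
    (hf : Function.Injective f) : InnerProductSpace.Core 𝕜 W where
  inner x y := c.inner (f x) (f y)
  conj_inner_symm x y := c.conj_inner_symm _ _
  re_inner_nonneg x := c.re_inner_nonneg _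
  add_left x y z := by simp only [map_add]; exact c.add_left _ _ _
  smul_left x y r := by simp only [map_smul]; exact c.smul_left _ _ _
  definite x hx := hf (by rw [map_zero]; exact c.definite _ hx)

/-- A positive definite hermitian form multiplied by a positive real number. -/
abbrev rescale (c : InnerProductSpace.Core 𝕜 V) (r : ℝ) (hr : 0 < r) :
    InnerProductSpace.Core 𝕜 V where
  inner x y := (r : 𝕜) * c.inner x y
  conj_inner_symm x y := by rw [map_mul, c.conj_inner_symm, RCLike.conj_ofReal]
  re_inner_nonneg x := by
    rw [RCLike.re_ofReal_mul]; exact mul_nonneg hr.le (c.re_inner_nonneg x)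
  add_left x y z := by rw [c.add_left, mul_add]
  smul_left x y s := by rw [c.smul_left]; ring
  definite x hx := c.definite x
    ((mul_eq_zero.1 hx).resolve_left (RCLike.ofReal_ne_zero.2 hr.ne'))

theorem form_re_pos (c : InnerProductSpace.Core 𝕜 V) {x : V} (hx : x ≠ 0) :
    0 < RCLike.re (c.inner x x) := by
  refine lt_of_le_of_ne (c.re_inner_nonneg x) fun h => hx (c.definite x ?_)
  have him : RCLike.im (c.inner x x) = 0 := RCLike.conj_eq_iff_im.1 (c.conj_inner_symm x x)
  rw [← RCLike.re_add_im (c.inner x x), ← h, him]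
  simp

theorem exists_orthogonal_section [Module.Finite 𝕜 V] (c : InnerProductSpace.Core 𝕜 V)
    (p : V →ₗ[𝕜] W) (hp : Function.Surjective p) :
    ∃ s : W →ₗ[𝕜] V, (∀ q, p (s q) = q) ∧ ∀ q, ∀ x ∈ LinearMap.ker p, c.inner x (s q) = 0 := by
  let : NormedAddCommGroup V := c.toNormedAddCommGroup
  let : InnerProductSpace 𝕜 V := InnerProductSpace.ofCore c.toCore
  let N := LinearMap.ker p
  have hc : IsCompl N Nᗮ := Submodule.isCompl_orthogonal N
  let e := p.quotKerEquivOfSurjective hp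
  let e' := Submodule.quotientEquivOfIsCompl N Nᗮ hc
  refine ⟨Nᗮ.subtype ∘ₗ e'.toLinearMap ∘ₗ e.symm.toLinearMap, fun q => ?_, fun q x hx => ?_⟩
  · obtain ⟨x, rfl⟩ := e.surjective q
    obtain ⟨y, rfl⟩ := e'.symm.surjective x
    simp [e, e']
  · exact (Submodule.mem_orthogonal N _).1 (e' (e.symm q)).2 x hx

/-- The quotient of a positive definite hermitian form by a surjective linear map `p`: the form
obtained by identifying the target with the orthogonal complement of the kernel of `p`. -/
abbrev quotientForm [Module.Finite 𝕜 V] (c : InnerProductSpace.Core 𝕜 V)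
    (p : V →ₗ[𝕜] W) (hp : Function.Surjective p) : InnerProductSpace.Core 𝕜 W :=
  pullback c (exists_orthogonal_section c p hp).choose
    (Function.LeftInverse.injective (exists_orthogonal_section c p hp).choose_spec.1)

end Forms

/-! ### Points and tangent spaces of a projective space -/

section Projective

variable {K E : Type*} [Field K] [AddCommGroup E] [Module K E]

/-- A nonzero vector of the line `D ⊆ E` corresponding to a point `P` of `ℙ(E)`. -/
def lineVector (P : ℙ K E) : P.submodule :=
  ⟨P.rep, by rw [P.submodule_eq]; exact Submodule.mem_span_singleton_self _⟩

theorem lineVector_ne_zero (P : ℙ K E) : lineVector P ≠ 0 := fun h =>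
  P.rep_nonzero (congrArg Subtype.val h)

theorem exists_smul_lineVector (P : ℙ K E) (x : P.submodule) : ∃ c : K, c • lineVector P = x := by
  obtain ⟨x, hx⟩ := x
  rw [P.submodule_eq, Submodule.mem_span_singleton] at hx
  obtain ⟨c, rfl⟩ := hx
  exact ⟨c, rfl⟩

theorem eval_injective (P : ℙ K E) {y : P.submodule} (hy : y ≠ 0) :
    Function.Injective (LinearMap.applyₗ y : (P.submodule →ₗ[K] E) →ₗ[K] E) := by
  intro f g hfg
  obtain ⟨c, hc⟩ := exists_smul_lineVector P y
  have hc0 : c ≠ 0 := by rintro rfl; exact hy (by rw [← hc, zero_smul])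
  ext x
  obtain ⟨d, rfl⟩ := exists_smul_lineVector P x
  have : lineVector P = c⁻¹ • y := by rw [← hc, smul_smul, inv_mul_cancel₀ hc0, one_smul]
  rw [this, smul_smul, map_smul, map_smul]
  exact congrArg _ hfg

theorem one_tmul_ne_zero (w : InfinitePlace K) {y : E} (hy : y ≠ 0) :
    (1 : w.Completion) ⊗ₜ[K] y ≠ 0 := by
  intro h
  apply hy
  have hinj := Module.Flat.rTensor_preserves_injective_linearMap (M := E)
    (Algebra.linearMap K w.Completion) (algebraMap K w.Completion).injective
  have h1 : (1 : K) ⊗ₜ[K] y = 0 := hinj (by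
    rw [LinearMap.rTensor_tmul, Algebra.linearMap_apply, map_one, h, map_zero])
  simpa using congrArg (TensorProduct.lid K E) h1

/-- The subspace `D^∨ ⊗ D = Hom(D, D)` of `D^∨ ⊗ E = Hom(D, E)`. -/
abbrev homSelf (P : ℙ K E) : Submodule K (P.submodule →ₗ[K] E) :=
  LinearMap.range (LinearMap.compRight K P.submodule.subtype :
    (P.submodule →ₗ[K] P.submodule) →ₗ[K] (P.submodule →ₗ[K] E))

/-- The tangent space `T_P ℙ(E) = (D^∨ ⊗ E) / (D^∨ ⊗ D)` at the point `P` of `ℙ(E)` corresponding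
to the line `D ⊆ E`. -/
abbrev TangentSpace (P : ℙ K E) : Type _ := (P.submodule →ₗ[K] E) ⧸ homSelf P

end Projective

/-! ### Adelically normed vector spaces over a number field -/

/-- A finite dimensional `K`-vector space `E` with a projective `𝓞 K`-submodule of maximal rank
and, for each archimedean place `w`, a positive definite hermitian (euclidean if `w` is real) form
on `E_w = K_w ⊗ E`. The norm of `y ∈ E_w` is `√⟨y, y⟩` for `w` real and `⟨y, y⟩` for `w` complex. -/
structure AdelicSpace (K E : Type*) [Field K] [NumberField K] [AddCommGroup E] [Module K E]
    [Module (𝓞 K) E] [IsScalarTower (𝓞 K) K E] where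
  lattice : Submodule (𝓞 K) E
  isLattice : Submodule.IsLattice K lattice
  form : ∀ w : InfinitePlace K, HermForm w (w.Completion ⊗[K] E)

section Lattices

variable {K E : Type*} [Field K] [AddCommGroup E] [Module K E]
  [Module (𝓞 K) E] [IsScalarTower (𝓞 K) K E]

theorem exists_smul_mem [NumberField K] {M : Submodule (𝓞 K) E} (h : Submodule.IsLattice K M) (x : E) :
    ∃ a : 𝓞 K, a ≠ 0 ∧ a • x ∈ M := by
  have hx : x ∈ Submodule.span K (M : Set E) := h.span_eq_top ▸ Submodule.mem_top
  induction hx using Submodule.span_induction with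
  | mem x hx => exact ⟨1, one_ne_zero, by simpa using hx⟩
  | zero => exact ⟨1, one_ne_zero, by simp⟩
  | add x y _ _ hx hy =>
    obtain ⟨a, ha, hax⟩ := hx
    obtain ⟨b, hb, hby⟩ := hy
    refine ⟨a * b, mul_ne_zero ha hb, ?_⟩
    rw [smul_add]
    refine M.add_mem ?_ ?_
    · rw [mul_comm, mul_smul]; exact M.smul_mem _ hax
    · rw [mul_smul]; exact M.smul_mem _ hby
  | smul c x _ hx =>
    obtain ⟨a, ha, hax⟩ := hx
    obtain ⟨p, q, hq, rfl⟩ := IsFractionRing.div_surjective (A := 𝓞 K) c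
    have hq0 : q ≠ 0 := nonZeroDivisors.ne_zero hq
    refine ⟨q * a, mul_ne_zero hq0 ha, ?_⟩
    have : (q * a) • (algebraMap (𝓞 K) K p / algebraMap (𝓞 K) K q) • x = p • a • x := by
      have hq' : algebraMap (𝓞 K) K q ≠ 0 := by simpa using hq0
      rw [← algebraMap_smul K (q * a), ← algebraMap_smul K p, ← algebraMap_smul K a, smul_smul,
        smul_smul, map_mul]
      congr 1
      field_simp
    rw [this]
    exact M.smul_mem _ hax

theorem isLattice_of {M : Submodule (𝓞 K) E} (hfg : M.FG)
    (h : ∀ x : E, ∃ a : 𝓞 K, a ≠ 0 ∧ a • x ∈ M) : Submodule.IsLattice K M where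
  fg := hfg
  span_eq_top := by
    rw [eq_top_iff]
    intro x _
    obtain ⟨a, ha, hax⟩ := h x
    have ha' : algebraMap (𝓞 K) K a ≠ 0 := by simpa using ha
    have : x = (algebraMap (𝓞 K) K a)⁻¹ • a • x := by
      rw [← algebraMap_smul K a x, smul_smul, inv_mul_cancel₀ ha', one_smul]
    rw [this]
    exact Submodule.smul_mem _ _ (Submodule.subset_span hax)

/-- For `v` a finite place and `M` an `𝓞 K`-submodule of a `K`-vector space, the `v`-adic norm
whose unit ball is the localization of `M` at `v`: the norm of `y` is the least `|a|_v` such that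
`y ∈ a M_v`, where `|·|_v` is normalized by `|a|_v = (N v) ^ (- v(a))`. -/
def finNorm [NumberField K] (M : Submodule (𝓞 K) E) (v : HeightOneSpectrum (𝓞 K)) (y : E) : ℝ :=
  sInf {r : ℝ | ∃ (a : K) (s : 𝓞 K) (z : E), s ∉ v.asIdeal ∧ z ∈ M ∧ s • y = a • z ∧
    r = HeightOneSpectrum.adicAbv K v a}

/-- The submodule `⋀^r M` of `⋀^r E`. -/
def extLattice (M : Submodule (𝓞 K) E) (r : ℕ) : Submodule (𝓞 K) ↥(⋀[K]^r E) :=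
  Submodule.span (𝓞 K) {ω | ∃ x : Fin r → E, (∀ i, x i ∈ M) ∧ ω = exteriorPower.ιMulti K r x}

end Lattices

namespace AdelicSpace

variable {K E : Type*} [Field K] [NumberField K] [AddCommGroup E] [Module K E]
  [Module (𝓞 K) E] [IsScalarTower (𝓞 K) K E]

theorem finite (A : AdelicSpace K E) : Module.Finite K E := by
  obtain ⟨s, hs⟩ := A.isLattice.fg
  refine ⟨s, ?_⟩
  rw [← A.isLattice.span_eq_top, ← hs]
  exact (Submodule.span_span_of_tower (𝓞 K) K (s : Set E)).symm

/-- A subspace `F ⊆ E` with the submodule `Λ ∩ F` and the restrictions of the norms. -/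
def restrict (A : AdelicSpace K E) (F : Submodule K E) : AdelicSpace K F where
  lattice := A.lattice.comap (F.subtype.restrictScalars (𝓞 K))
  isLattice := by
    refine isLattice_of ?_ fun x => ?_
    · have : Module.Finite (𝓞 K) A.lattice := Module.Finite.iff_fg.2 A.isLattice.fg
      exact Submodule.fg_of_fg_map_injective (F.subtype.restrictScalars (𝓞 K))
        F.injective_subtype
        (Submodule.FG.of_le A.isLattice.fg (Submodule.map_comap_le _ _))
    · exact exists_smul_mem A.isLattice (x : E)
  form w :=
    letI := completionRCLike w
    pullback (A.form w) (F.subtype.baseChange w.Completion)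
      (Module.Flat.lTensor_preserves_injective_linearMap F.subtype F.injective_subtype)

/-- The quotient `E / F` with the image of `Λ` and the quotient norms. -/
def quotient (A : AdelicSpace K E) (F : Submodule K E) : AdelicSpace K (E ⧸ F) where
  lattice := A.lattice.map (F.mkQ.restrictScalars (𝓞 K))
  isLattice := by
    refine isLattice_of (A.isLattice.fg.map _) fun x => ?_
    obtain ⟨x, rfl⟩ := F.mkQ_surjective x
    obtain ⟨a, ha, hax⟩ := exists_smul_mem A.isLattice x
    exact ⟨a, ha, a • x, hax, rfl⟩
  form w :=
    letI := completionRCLike w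
    letI := A.finite
    quotientForm (A.form w) (F.mkQ.baseChange w.Completion)
      (LinearMap.lTensor_surjective w.Completion F.mkQ_surjective)

/-- The norm of `x_1 ∧ ⋯ ∧ x_r` at an archimedean place, where the exterior power of `E_w` is
normed so that `e_1 ∧ ⋯ ∧ e_r` has norm `1` for `e_1, …, e_r` orthonormal: it is given by the Gram
determinant of `x_1, …, x_r` if `w` is complex, by its square root if `w` is real. -/
def archNorm (A : AdelicSpace K E) (w : InfinitePlace K) {r : ℕ} (x : Fin r → E) : ℝ :=
  (√((completionRCLike w).re (Matrix.det (Matrix.of fun i j : Fin r =>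
    (A.form w).inner (1 ⊗ₜ[K] x i) (1 ⊗ₜ[K] x j))))) ^ w.mult

/-- The sum `- ∑_w log ‖y‖_w` over all places `w` of `K`, for `y = x_1 ∧ ⋯ ∧ x_r ∈ ⋀^r E`. -/
def degWith (A : AdelicSpace K E) {r : ℕ} (x : Fin r → E) : ℝ :=
  -(∑ᶠ v : HeightOneSpectrum (𝓞 K),
      Real.log (finNorm (extLattice A.lattice r) v (exteriorPower.ιMulti K r x)) +
    ∑ w : InfinitePlace K, Real.log (A.archNorm w x))

/-- The arithmetic degree of `E`: the sum `- ∑_w log ‖y‖_w` for `y ≠ 0` in the line `⋀^r E`, where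
`r = dim E`. By the product formula it does not depend on `y`; we take `y = x_1 ∧ ⋯ ∧ x_r` for some
basis `x` of `E`. -/
def deg [FiniteDimensional K E] (A : AdelicSpace K E) : ℝ :=
  A.degWith (Module.finBasis K E)

/-- The Newton polygon: the convex hull of the points `(dim F, deg F)`, `F` a subspace of `E`. -/
def newtonPolygon [FiniteDimensional K E] (A : AdelicSpace K E) : Set (ℝ × ℝ) :=
  convexHull ℝ {p | ∃ F : Submodule K E, p = ((Module.finrank K F : ℝ), (A.restrict F).deg)}

/-- The function `m_E` whose graph is the upper boundary of the Newton polygon. -/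
def upperBoundary [FiniteDimensional K E] (A : AdelicSpace K E) (x : ℝ) : ℝ :=
  sSup {y : ℝ | (x, y) ∈ A.newtonPolygon}

/-- The slopes `μ_i(E) = m_E(i) - m_E(i - 1)`, for `1 ≤ i ≤ dim E`. -/
def slope [FiniteDimensional K E] (A : AdelicSpace K E) (i : ℕ) : ℝ :=
  A.upperBoundary i - A.upperBoundary (i - 1)

/-- For a point `P` of `ℙ(E)` with corresponding line `D ⊆ E`, the space `D^∨ ⊗ E = Hom(D, E)` with
the lattice of all `f` mapping `Λ ∩ D` to `Λ`, and with the forms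
`⟨f, g⟩_w = ⟨f(y), g(y)⟩_w / ⟨y, y⟩_w`, where `y` is any nonzero vector of `D`. -/
def homLine (A : AdelicSpace K E) (P : ℙ K E) : AdelicSpace K (P.submodule →ₗ[K] E) where
  lattice :=
    { carrier := {f | ∀ x : P.submodule, (x : E) ∈ A.lattice → f x ∈ A.lattice}
      add_mem' := fun hf hg x hx => A.lattice.add_mem (hf x hx) (hg x hx)
      zero_mem' := fun _ _ => A.lattice.zero_mem
      smul_mem' := fun a _ hf x hx => A.lattice.smul_mem a (hf x hx) }
  isLattice := by
    refine isLattice_of ?_ fun f => ?_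
    · obtain ⟨a, ha, hay⟩ := exists_smul_mem A.isLattice (lineVector P : E)
      have ha' : algebraMap (𝓞 K) K a ≠ 0 := by simpa using ha
      have hy : a • lineVector P ≠ 0 := by
        rw [← algebraMap_smul K a]
        exact smul_ne_zero ha' (lineVector_ne_zero P)
      have : Module.Finite (𝓞 K) A.lattice := Module.Finite.iff_fg.2 A.isLattice.fg
      refine Submodule.fg_of_fg_map_injective
        ((LinearMap.applyₗ (a • lineVector P) :
          (P.submodule →ₗ[K] E) →ₗ[K] E).restrictScalars (𝓞 K))
        (eval_injective P hy) (Submodule.FG.of_le A.isLattice.fg ?_)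
      rintro _ ⟨f, hf, rfl⟩
      exact hf (a • lineVector P) hay
    · obtain ⟨s, hs⟩ := (A.restrict P.submodule).isLattice.fg
      have key : ∀ t : Finset P.submodule, ∃ a : 𝓞 K, a ≠ 0 ∧ ∀ x ∈ t, a • f x ∈ A.lattice := by
        intro t
        induction t using Finset.cons_induction with
        | empty => exact ⟨1, one_ne_zero, by simp⟩
        | cons x t hx ih =>
          obtain ⟨a, ha, hat⟩ := ih
          obtain ⟨b, hb, hbx⟩ := exists_smul_mem A.isLattice (f x)
          refine ⟨a * b, mul_ne_zero ha hb, fun z hz => ?_⟩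
          rcases Finset.mem_cons.1 hz with rfl | hz
          · rw [mul_smul]; exact A.lattice.smul_mem _ hbx
          · rw [mul_comm, mul_smul]; exact A.lattice.smul_mem _ (hat z hz)
      obtain ⟨a, ha, has⟩ := key s
      refine ⟨a, ha, fun x hx => ?_⟩
      have hx' : x ∈ Submodule.span (𝓞 K) (s : Set P.submodule) := by rw [hs]; exact hx
      have hle : Submodule.span (𝓞 K) (s : Set P.submodule) ≤
          A.lattice.comap ((a • f).restrictScalars (𝓞 K)) :=
        Submodule.span_le.2 fun z hz => has z hz
      exact hle hx'
  form w :=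
    letI := completionRCLike w
    let y : w.Completion ⊗[K] E := 1 ⊗ₜ[K] (lineVector P : E)
    rescale
      (pullback (A.form w)
        ((LinearMap.applyₗ (lineVector P) : (P.submodule →ₗ[K] E) →ₗ[K] E).baseChange w.Completion)
        (Module.Flat.lTensor_preserves_injective_linearMap _
          (eval_injective P (lineVector_ne_zero P))))
      (RCLike.re ((A.form w).inner y y))⁻¹
      (inv_pos.2 (form_re_pos (A.form w)
        (one_tmul_ne_zero w fun h => lineVector_ne_zero P (Subtype.ext h))))

/-- The tangent space `T_P ℙ(E)` with the adelic norm given by the Euler sequence: the quotient of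
`D^∨ ⊗ E` by `D^∨ ⊗ D`. -/
def tangent (A : AdelicSpace K E) (P : ℙ K E) : AdelicSpace K (TangentSpace P) :=
  (A.homLine P).quotient (homSelf P)

/-- The logarithmic height `h(P) = deg(T_P ℙ(E))` attached to the anticanonical line bundle. -/
def height [FiniteDimensional K E] (A : AdelicSpace K E) (P : ℙ K E) : ℝ :=
  (A.tangent P).deg

/-- The freeness `l(P)` of a point `P` of `ℙ(E)`: with `n = dim T_P ℙ(E)`, it is
`n μ_n(T_P ℙ(E)) / h(P)` if `μ_n(T_P ℙ(E)) > 0`, and `0` otherwise. -/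
def freeness [FiniteDimensional K E] (A : AdelicSpace K E) (P : ℙ K E) : ℝ :=
  let n := Module.finrank K (TangentSpace P)
  if 0 < (A.tangent P).slope n then n * (A.tangent P).slope n / A.height P else 0

variable (K) in
/-- The space `K^m` with the lattice `(𝓞 K)^m` and with the standard scalar products
`∑_i conj(x_i) y_i` at the archimedean places. -/
def standard (m : ℕ) : AdelicSpace K (Fin m → K) where
  lattice := Submodule.pi Set.univ fun _ => LinearMap.range (Algebra.linearMap (𝓞 K) K)
  isLattice := by
    refine isLattice_of ?_ fun x => ?_
    · refine Submodule.fg_pi fun _ => ?_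
      rw [LinearMap.range_eq_map]
      exact Module.Finite.fg_top.map _
    · obtain ⟨b, hb⟩ := IsLocalization.exist_integer_multiples_of_finite
        (nonZeroDivisors (𝓞 K)) x
      exact ⟨b, nonZeroDivisors.ne_zero b.2, fun i _ => hb i⟩
  form w :=
    letI := completionRCLike w
    pullback (InnerProductSpace.toCore (𝕜 := w.Completion) (E := EuclideanSpace w.Completion (Fin m)))
      ((WithLp.linearEquiv 2 w.Completion (Fin m → w.Completion)).symm.toLinearMap ∘ₗ
        (TensorProduct.piScalarRight K w.Completion w.Completion (Fin m)).toLinearMap)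
      ((WithLp.linearEquiv 2 w.Completion (Fin m → w.Completion)).symm.injective.comp
        (TensorProduct.piScalarRight K w.Completion w.Completion (Fin m)).injective)

end AdelicSpace
end Arakelov

/-!
Write `D ⊆ E = K^{n+1}` for the line of `P` and `T` for the tangent space at `P`. A generator of `D`
gives a surjection `tangentMap P : E → T` with kernel `D`, so the subspaces of `T` are the images
`T_F` of the subspaces `F` with `D ⊆ F ⊆ E`. The theorem follows from three facts.

* `deg T_F = deg F - (dim F) deg D` (`deg_tangent_restrict`). The degree can be computed with any
  basis because of the product formula (`deg_eq`), and for the bases `(d, f_1, …, f_k)` of `F` and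
  `(f_1, …, f_k)` of `T_F` the identity holds place by place, the norm of `d` entering `k + 1` times.
  At a finite place, lattices have bases over the valuation ring (`exists_isLocalBasis`), the norm
  in the top exterior power is a determinant in such a basis (`finNorm_eq`), and the determinants
  are compared in a basis adapted to `D` (`locNorm_tangent`). At an archimedean place, the norm is a
  Gram determinant, and the Gram determinant of `(d, f_1, …, f_k)` splits off the factor `⟨d, d⟩`
  (`gramDet_cons`, `archGram_tangent`).
* The last slope is the minimum of `(deg T - deg T') / (dim T - dim T')` over the proper subspaces
  `T'` (`slope_finrank_eq`): the line of this slope through `(dim T, deg T)` lies above the Newton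
  polygon and meets it to the left of `dim T`. As `deg E = 0`, the first fact turns the quotient for
  `T' = T_F` into `- deg F / codim F - deg D`, where `- deg D = h(P) / (n + 1)`.
* The minimum exists, and `deg F ≤ 0` for all `F ⊆ E`. A subspace has a basis some of whose
  coordinates form the identity matrix (`exists_reduced_basis`). All maximal minors of the basis
  are bounded by the local norms (`adicAbv_minor_le`, `minor_sq_le_archGram`). The minor `1` gives
  `deg F ≤ 0`, and the entries of the basis, which are minors as well, have logarithmic height at
  most `- deg F`. By the Northcott property of `K`, only finitely many `F` have degree above a given
  bound (`finite_le_deg`).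
-/

set_option linter.unusedSectionVars false

namespace Arakelov

/-! ### The `v`-adic absolute value and localizations of lattices -/

section Local

open Module

variable {K E : Type*} [Field K] [NumberField K] [AddCommGroup E] [Module K E]
  [Module (𝓞 K) E] [IsScalarTower (𝓞 K) K E] (v : HeightOneSpectrum (𝓞 K))

theorem adicAbv_algebraMap_le_one (s : 𝓞 K) :
    HeightOneSpectrum.adicAbv K v (algebraMap (𝓞 K) K s) ≤ 1 :=
  v.adicAbv_coe_le_one (HeightOneSpectrum.one_lt_absNorm_nnreal v) s

theorem adicAbv_algebraMap_eq_one {s : 𝓞 K} (hs : s ∉ v.asIdeal) :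
    HeightOneSpectrum.adicAbv K v (algebraMap (𝓞 K) K s) = 1 :=
  (v.adicAbv_coe_eq_one_iff (HeightOneSpectrum.one_lt_absNorm_nnreal v) s).2 hs

theorem exists_mul_eq_algebraMap {a : K} (ha : HeightOneSpectrum.adicAbv K v a ≤ 1) :
    ∃ s p : 𝓞 K, s ∉ v.asIdeal ∧ algebraMap (𝓞 K) K s * a = algebraMap (𝓞 K) K p := by
  have h : v.valuation K a ≤ 1 := by
    rw [HeightOneSpectrum.adicAbv_def] at ha
    exact (WithZeroMulInt.toNNReal_le_one_iff (HeightOneSpectrum.one_lt_absNorm_nnreal v)).1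
      (by exact_mod_cast ha)
  obtain ⟨p, s, h⟩ := HeightOneSpectrum.exists_primeCompl_mul_eq_of_integer v a h
  exact ⟨s, p, s.2, by rw [mul_comm]; exact h⟩

theorem adicAbv_sum_le {ι : Type*} (s : Finset ι) (f : ι → K) {C : ℝ} (hC : 0 ≤ C)
    (h : ∀ i ∈ s, HeightOneSpectrum.adicAbv K v (f i) ≤ C) :
    HeightOneSpectrum.adicAbv K v (∑ i ∈ s, f i) ≤ C := by
  induction s using Finset.cons_induction with
  | empty => simpa using hC
  | cons i s hi ih =>
    rw [Finset.sum_cons]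
    exact (HeightOneSpectrum.adicAbv_add_le_max K v _ _).trans
      (max_le (h i (by simp)) (ih fun j hj => h j (by simp [hj])))

theorem adicAbv_det_le_one {r : ℕ} (A : Matrix (Fin r) (Fin r) K)
    (h : ∀ i j, HeightOneSpectrum.adicAbv K v (A i j) ≤ 1) :
    HeightOneSpectrum.adicAbv K v A.det ≤ 1 := by
  rw [Matrix.det_apply]
  refine adicAbv_sum_le v _ _ zero_le_one fun σ _ => ?_
  rcases Int.units_eq_one_or (Equiv.Perm.sign σ) with hσ | hσ <;>
  · rw [hσ]
    simp only [one_smul, Units.neg_smul, AbsoluteValue.map_neg, map_prod]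
    exact Finset.prod_le_one (fun _ _ => AbsoluteValue.nonneg _ _) fun _ _ => h _ _

/-- If each member of a finite family has a multiple in `M` by an element of a submonoid `S`, there
is a common such multiplier. -/
theorem exists_common_smul_mem (M : Submodule (𝓞 K) E) (S : Submonoid (𝓞 K)) {ι : Type*} [Finite ι]
    (y : ι → E) (h : ∀ i, ∃ s ∈ S, s • y i ∈ M) : ∃ s ∈ S, ∀ i, s • y i ∈ M := by
  classical
  have := Fintype.ofFinite ι
  choose s hs hsy using h
  refine ⟨∏ i, s i, S.prod_mem fun i _ => hs i, fun i => ?_⟩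
  rw [← Finset.prod_erase_mul _ _ (Finset.mem_univ i), mul_smul]
  exact M.smul_mem _ (hsy i)

/-- The localization of `M` at the finite place `v`, as a submodule of the ambient vector space. -/
def localization (M : Submodule (𝓞 K) E) : Submodule (𝓞 K) E where
  carrier := {y | ∃ s ∈ v.asIdeal.primeCompl, s • y ∈ M}
  zero_mem' := ⟨1, one_mem _, by simp⟩
  add_mem' := by
    rintro x y ⟨s, hs, hsx⟩ ⟨t, ht, hty⟩
    refine ⟨s * t, mul_mem hs ht, ?_⟩
    rw [smul_add]
    refine M.add_mem ?_ ?_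
    · rw [mul_comm, mul_smul]; exact M.smul_mem _ hsx
    · rw [mul_smul]; exact M.smul_mem _ hty
  smul_mem' := by
    rintro a x ⟨s, hs, hsx⟩
    exact ⟨s, hs, by rw [smul_comm]; exact M.smul_mem _ hsx⟩

variable {v} {M : Submodule (𝓞 K) E}

theorem le_localization : M ≤ localization v M := fun y hy => ⟨1, one_mem _, by simpa using hy⟩

theorem ne_zero_of_mem_primeCompl {s : 𝓞 K} (hs : s ∈ v.asIdeal.primeCompl) :
    algebraMap (𝓞 K) K s ≠ 0 := by
  rw [Ne, FaithfulSMul.algebraMap_eq_zero_iff]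
  rintro rfl
  exact hs v.asIdeal.zero_mem

theorem mem_localization_of_smul_mem {s : 𝓞 K} (hs : s ∈ v.asIdeal.primeCompl) {y : E}
    (h : s • y ∈ localization v M) : y ∈ localization v M := by
  obtain ⟨t, ht, h⟩ := h
  exact ⟨t * s, mul_mem ht hs, by rwa [mul_smul]⟩

theorem smul_mem_localization {a : K} (ha : HeightOneSpectrum.adicAbv K v a ≤ 1) {y : E}
    (hy : y ∈ localization v M) : a • y ∈ localization v M := by
  obtain ⟨s, p, hs, h⟩ := exists_mul_eq_algebraMap v ha
  refine mem_localization_of_smul_mem (s := s) hs ?_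
  rw [← algebraMap_smul K s, smul_smul, h, algebraMap_smul]
  exact Submodule.smul_mem _ _ hy

variable (v M) in
/-- A basis `e` of a vector space is a local basis of the lattice `M` at `v` if it is a basis of the
localization of `M` over the valuation ring of `v`. -/
def IsLocalBasis {ι : Type*} (e : Basis ι K E) : Prop :=
  ∀ y, y ∈ localization v M ↔ ∀ i, HeightOneSpectrum.adicAbv K v (e.repr y i) ≤ 1

theorem isLocalBasis_of {ι : Type*} [Finite ι] {e : Basis ι K E}
    (h1 : ∀ i, e i ∈ localization v M)
    (h2 : ∀ y ∈ M, ∀ i, HeightOneSpectrum.adicAbv K v (e.repr y i) ≤ 1) : IsLocalBasis v M e := by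
  have := Fintype.ofFinite ι
  refine fun y => ⟨fun ⟨s, hs, hsy⟩ i => ?_, fun h => ?_⟩
  · have := h2 _ hsy i
    rwa [← algebraMap_smul K s, map_smul, Finsupp.smul_apply, smul_eq_mul, map_mul,
      adicAbv_algebraMap_eq_one v hs, one_mul] at this
  · rw [← e.sum_repr y]
    exact Submodule.sum_mem _ fun i _ => smul_mem_localization (h i) (h1 i)

theorem IsLocalBasis.mem {ι : Type*} {e : Basis ι K E} (he : IsLocalBasis v M e) (i : ι) :
    e i ∈ localization v M := by
  classical
  refine (he _).2 fun j => ?_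
  rw [e.repr_self, Finsupp.single_apply]
  split_ifs <;> simp

theorem IsLocalBasis.adicAbv_det_le_one {r : ℕ} {e : Basis (Fin r) K E} (he : IsLocalBasis v M e)
    {x : Fin r → E} (hx : ∀ i, x i ∈ localization v M) :
    HeightOneSpectrum.adicAbv K v (e.det x) ≤ 1 := by
  rw [e.det_apply]
  exact Arakelov.adicAbv_det_le_one v _ fun i j => (he _).1 (hx j) i

theorem ιMulti_eq_det_smul {r : ℕ} (e : Basis (Fin r) K E) (x : Fin r → E) :
    exteriorPower.ιMulti K r x = e.det x • exteriorPower.ιMulti K r e := by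
  have h := e.ext_alternating (f := exteriorPower.ιMulti K r)
    (g := (LinearMap.toSpanSingleton K _ (exteriorPower.ιMulti K r e)).compAlternatingMap e.det) ?_
  · exact DFunLike.congr_fun h x
  · intro σ hσ
    have := e.det.map_perm e (Equiv.ofBijective σ (Finite.injective_iff_bijective.1 hσ))
    have h' := (exteriorPower.ιMulti K r (M := E)).map_perm e
      (Equiv.ofBijective σ (Finite.injective_iff_bijective.1 hσ))
    have e1 : (fun i => e (σ i)) = e ∘ (Equiv.ofBijective σ (Finite.injective_iff_bijective.1 hσ)) := rfl
    rw [e1, h', LinearMap.compAlternatingMap_apply, this, e.det_self, map_zsmul_unit]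
    simp

/-- An alternating form that is `v`-integral on `M` is `v`-integral on `⋀^r M`. -/
theorem adicAbv_form_extLattice_le_one {r : ℕ} (f : E [⋀^Fin r]→ₗ[K] K)
    (hf : ∀ x : Fin r → E, (∀ i, x i ∈ M) → HeightOneSpectrum.adicAbv K v (f x) ≤ 1)
    {z : ⋀[K]^r E} (hz : z ∈ extLattice M r) :
    HeightOneSpectrum.adicAbv K v (exteriorPower.alternatingMapLinearEquiv f z) ≤ 1 := by
  induction hz using Submodule.span_induction with
  | mem z hz =>
    obtain ⟨x, hx, rfl⟩ := hz
    rw [exteriorPower.alternatingMapLinearEquiv_apply_ιMulti]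
    exact hf x hx
  | zero => simp
  | add x y _ _ hx hy =>
    rw [map_add]
    exact (HeightOneSpectrum.adicAbv_add_le_max K v _ _).trans (max_le hx hy)
  | smul a x _ hx =>
    rw [← algebraMap_smul K a, map_smul, smul_eq_mul, map_mul]
    exact mul_le_one₀ (adicAbv_algebraMap_le_one v a) (AbsoluteValue.nonneg _ _) hx

theorem adicAbv_form_le_of_smul_eq {r : ℕ} (f : E [⋀^Fin r]→ₗ[K] K)
    (hf : ∀ x : Fin r → E, (∀ i, x i ∈ M) → HeightOneSpectrum.adicAbv K v (f x) ≤ 1)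
    {x : Fin r → E} {a : K} {s : 𝓞 K} {z : ⋀[K]^r E} (hs : s ∉ v.asIdeal)
    (hz : z ∈ extLattice M r) (h : s • exteriorPower.ιMulti K r x = a • z) :
    HeightOneSpectrum.adicAbv K v (f x) ≤ HeightOneSpectrum.adicAbv K v a := by
  have h := congrArg (fun t => HeightOneSpectrum.adicAbv K v
    (exteriorPower.alternatingMapLinearEquiv f t))
    ((algebraMap_smul K s (exteriorPower.ιMulti K r x)).trans h)
  beta_reduce at h
  rw [LinearMap.map_smul, LinearMap.map_smul, smul_eq_mul, smul_eq_mul, map_mul, map_mul,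
    adicAbv_algebraMap_eq_one v hs, one_mul,
    exteriorPower.alternatingMapLinearEquiv_apply_ιMulti] at h
  rw [h]
  exact mul_le_of_le_one_right (AbsoluteValue.nonneg _ _) (adicAbv_form_extLattice_le_one f hf hz)

/-- The `v`-adic norm of `x_1 ∧ ⋯ ∧ x_r` in the top exterior power is the absolute value of the
determinant of `x` with respect to a local basis. -/
theorem finNorm_eq {r : ℕ} {e : Basis (Fin r) K E} (he : IsLocalBasis v M e) (x : Fin r → E) :
    finNorm (extLattice M r) v (exteriorPower.ιMulti K r x) =
      HeightOneSpectrum.adicAbv K v (e.det x) := by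
  refine IsLeast.csInf_eq ⟨?_, ?_⟩
  · obtain ⟨s, hs, hse⟩ := exists_common_smul_mem M v.asIdeal.primeCompl e fun i => he.mem i
    refine ⟨e.det x, s ^ r, exteriorPower.ιMulti K r fun i => s • e i, pow_mem hs r,
      Submodule.subset_span ⟨_, hse, rfl⟩, ?_, rfl⟩
    have : (fun i => s • e i) = fun i => (fun _ : Fin r => algebraMap (𝓞 K) K s) i • e i := by
      ext; simp
    rw [this, AlternatingMap.map_smul_univ, Finset.prod_const, Finset.card_univ, Fintype.card_fin,
      ιMulti_eq_det_smul e x, ← algebraMap_smul K (s ^ r), map_pow, smul_comm]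
  · rintro _ ⟨a, s, z, hs, hz, h, rfl⟩
    exact adicAbv_form_le_of_smul_eq e.det
      (fun x hx => he.adicAbv_det_le_one fun i => le_localization (hx i)) hs hz h

/-- Alternating `r`-forms that are `v`-integral on `M` bound the `v`-adic norm on `⋀^r E` from
below. -/
theorem le_finNorm {r : ℕ} (hM : Submodule.IsLattice K M) (f : E [⋀^Fin r]→ₗ[K] K)
    (hf : ∀ x : Fin r → E, (∀ i, x i ∈ M) → HeightOneSpectrum.adicAbv K v (f x) ≤ 1)
    (x : Fin r → E) :
    HeightOneSpectrum.adicAbv K v (f x) ≤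
      finNorm (extLattice M r) v (exteriorPower.ιMulti K r x) := by
  refine le_csInf ?_ ?_
  · obtain ⟨a, ha, hax⟩ := exists_common_smul_mem M (nonZeroDivisors (𝓞 K)) x fun i => by
      obtain ⟨a, ha, h⟩ := exists_smul_mem hM (x i)
      exact ⟨a, mem_nonZeroDivisors_of_ne_zero ha, h⟩
    have ha' : algebraMap (𝓞 K) K a ≠ 0 := by simpa using nonZeroDivisors.ne_zero ha
    refine ⟨_, (algebraMap (𝓞 K) K a ^ r)⁻¹, 1, exteriorPower.ιMulti K r fun i => a • x i,
      fun h => v.isPrime.ne_top ((Ideal.eq_top_iff_one _).2 h),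
      Submodule.subset_span ⟨_, hax, rfl⟩, ?_, rfl⟩
    have : (fun i => a • x i) = fun i => (fun _ : Fin r => algebraMap (𝓞 K) K a) i • x i := by
      ext; simp
    rw [this, AlternatingMap.map_smul_univ, Finset.prod_const, Finset.card_univ, Fintype.card_fin,
      smul_smul, inv_mul_cancel₀ (pow_ne_zero r ha')]
    simp
  · rintro _ ⟨a, s, z, hs, hz, h, rfl⟩
    exact adicAbv_form_le_of_smul_eq f hf hs hz h

/-- Lattices have local bases: among the tuples of elements of a finite set of generators, one whose
determinant has the largest absolute value is a local basis, by Cramer's rule. -/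
theorem exists_isLocalBasis (hM : Submodule.IsLattice K M) {r : ℕ} (b : Basis (Fin r) K E) :
    ∃ e : Basis (Fin r) K E, IsLocalBasis v M e := by
  classical
  obtain ⟨S, hS⟩ := hM.fg
  have hspan : Submodule.span K (S : Set E) = ⊤ := by
    rw [← hM.span_eq_top, ← hS]
    exact (Submodule.span_span_of_tower (𝓞 K) K (S : Set E)).symm
  have hr : r = finrank K (Submodule.span K (S : Set E)) := by
    rw [hspan, finrank_top, finrank_eq_card_basis b, Fintype.card_fin]
  obtain ⟨f₀, hf₀S, hf₀, hf₀i⟩ : ∃ f : Fin r → E, (∀ i, f i ∈ S) ∧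
      Submodule.span K (Set.range f) = ⊤ ∧ LinearIndependent K f := by
    subst hr
    rw [← hspan]
    exact Submodule.exists_fun_fin_finrank_span_eq K (S : Set E)
  let f₀' : Fin r → S := fun i => ⟨f₀ i, hf₀S i⟩
  have : Nonempty (Fin r → S) := ⟨f₀'⟩
  obtain ⟨f, hf⟩ := Finite.exists_max fun f : Fin r → S =>
    HeightOneSpectrum.adicAbv K v (b.det fun i => (f i : E))
  have hdet : b.det (fun i => (f i : E)) ≠ 0 := by
    intro h
    have h0 := hf f₀'
    rw [h, map_zero] at h0
    have h1 := (AbsoluteValue.eq_zero _).1 (le_antisymm h0 (AbsoluteValue.nonneg _ _))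
    exact ((Basis.is_basis_iff_det b).1 ⟨hf₀i, hf₀⟩).ne_zero h1
  obtain ⟨hli, hsp⟩ := (Basis.is_basis_iff_det b).2 (IsUnit.mk0 _ hdet)
  refine ⟨Basis.mk hli hsp.ge, isLocalBasis_of (fun i => ?_) fun y hy i => ?_⟩
  · rw [Basis.mk_apply]
    exact le_localization (hS ▸ Submodule.subset_span (f i).2)
  -- Cramer's rule expresses the coordinates in the basis `f` as quotients of determinants; for the
  -- generators these are determinants of tuples of generators.
  · have hc : ∀ z, HeightOneSpectrum.adicAbv K v (b.det fun i => (f i : E)) *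
        HeightOneSpectrum.adicAbv K v ((Basis.mk hli hsp.ge).repr z i) =
        HeightOneSpectrum.adicAbv K v (b.det (Function.update (fun i => (f i : E)) i z)) := by
      intro z
      rw [← map_mul]
      exact congrArg _ (DFunLike.congr_fun (b.det_smul_mk_coord_eq_det_update hli hsp.ge i) z)
    rw [← hS] at hy
    induction hy using Submodule.span_induction with
    | mem z hz =>
      have h := hf (Function.update f i ⟨z, hz⟩)
      have e1 : (fun j => ((Function.update f i ⟨z, hz⟩ j : S) : E)) =
          Function.update (fun i => (f i : E)) i z := by
        ext j
        by_cases hj : j = i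
        · subst hj; simp
        · simp [hj]
      rw [e1, ← hc] at h
      exact le_of_mul_le_mul_left (by simpa using h) ((AbsoluteValue.pos_iff _).2 hdet)
    | zero => rw [map_zero, Finsupp.zero_apply, map_zero]; exact zero_le_one
    | add x y _ _ hx hy =>
      rw [map_add, Finsupp.add_apply]
      exact (HeightOneSpectrum.adicAbv_add_le_max K v _ _).trans (max_le hx hy)
    | smul a x _ hx =>
      rw [← algebraMap_smul K a, map_smul, Finsupp.smul_apply, smul_eq_mul, map_mul]
      exact mul_le_one₀ (adicAbv_algebraMap_le_one v a) (AbsoluteValue.nonneg _ _) hx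

theorem finNorm_pos (hM : Submodule.IsLattice K M) {r : ℕ} (x : Basis (Fin r) K E) :
    0 < finNorm (extLattice M r) v (exteriorPower.ιMulti K r x) := by
  obtain ⟨e, he⟩ := exists_isLocalBasis (v := v) hM x
  rw [finNorm_eq he, AbsoluteValue.pos_iff]
  exact (e.isUnit_det x).ne_zero

/-- The change of basis formula for `v`-adic norms. -/
theorem finNorm_basis (hM : Submodule.IsLattice K M) {r : ℕ} (x x' : Basis (Fin r) K E) :
    finNorm (extLattice M r) v (exteriorPower.ιMulti K r x') =
      HeightOneSpectrum.adicAbv K v (x.det x') *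
        finNorm (extLattice M r) v (exteriorPower.ιMulti K r x) := by
  obtain ⟨e, he⟩ := exists_isLocalBasis (v := v) hM x
  rw [finNorm_eq he, finNorm_eq he, ← map_mul, mul_comm, e.det_apply, e.det_apply, x.det_apply,
    ← Matrix.det_mul, Basis.toMatrix_mul_toMatrix]

theorem finite_asIdeal_mem {a : 𝓞 K} (ha : a ≠ 0) :
    {v : HeightOneSpectrum (𝓞 K) | a ∈ v.asIdeal}.Finite := by
  have : Ideal.span {a} ≠ 0 := by simpa using ha
  simpa [Ideal.dvd_span_singleton] using Ideal.finite_factors this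

/-- All but finitely many of the local norms are `1`, since a given basis is a local basis at all but
finitely many places. -/
theorem finite_finNorm_ne_one (hM : Submodule.IsLattice K M) {r : ℕ} (x : Basis (Fin r) K E) :
    {v | finNorm (extLattice M r) v (exteriorPower.ιMulti K r x) ≠ 1}.Finite := by
  obtain ⟨a, ha, hax⟩ := exists_common_smul_mem M (nonZeroDivisors (𝓞 K)) x fun i => by
    obtain ⟨a, ha, h⟩ := exists_smul_mem hM (x i)
    exact ⟨a, mem_nonZeroDivisors_of_ne_zero ha, h⟩
  obtain ⟨S, hS⟩ := hM.fg
  classical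
  -- `b` is a common denominator of the coordinates of the generators of `M`
  obtain ⟨⟨b, hb⟩, hbS⟩ := IsLocalization.exist_integer_multiples_of_finset (nonZeroDivisors (𝓞 K))
    (Finset.univ.biUnion fun i => S.image fun y => x.repr y i)
  refine (finite_asIdeal_mem (nonZeroDivisors.ne_zero (mul_mem ha hb))).subset fun v hv => ?_
  by_contra hab
  have hav : a ∈ v.asIdeal.primeCompl := fun h => hab (Ideal.mul_mem_right _ _ h)
  have hbv : b ∉ v.asIdeal := fun h => hab (Ideal.mul_mem_left _ _ h)
  refine hv ?_
  have he : IsLocalBasis v M x := by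
    refine isLocalBasis_of (fun i => ⟨a, hav, hax i⟩) fun y hy i => ?_
    rw [← hS] at hy
    induction hy using Submodule.span_induction with
    | mem y hy =>
      obtain ⟨p, hp⟩ := hbS (x.repr y i) (Finset.mem_biUnion.2
        ⟨i, Finset.mem_univ i, Finset.mem_image_of_mem _ hy⟩)
      have := adicAbv_algebraMap_le_one v p
      rwa [hp, ← algebraMap_smul K, smul_eq_mul, map_mul, adicAbv_algebraMap_eq_one v hbv,
        one_mul] at this
    | zero => rw [map_zero, Finsupp.zero_apply, map_zero]; exact zero_le_one
    | add x y _ _ hx hy =>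
      rw [map_add, Finsupp.add_apply]
      exact (HeightOneSpectrum.adicAbv_add_le_max K v _ _).trans (max_le hx hy)
    | smul a x _ hx =>
      rw [← algebraMap_smul K a, map_smul, Finsupp.smul_apply, smul_eq_mul, map_mul]
      exact mul_le_one₀ (adicAbv_algebraMap_le_one v a) (AbsoluteValue.nonneg _ _) hx
  rw [finNorm_eq he, x.det_self, map_one]

end Local

/-! ### Gram determinants -/

section Gram

variable {𝕜 V : Type*} [RCLike 𝕜] [AddCommGroup V] [Module 𝕜 V]

/-- The Gram determinant of a finite family of vectors. -/
def gramDet (c : InnerProductSpace.Core 𝕜 V) {r : ℕ} (x : Fin r → V) : 𝕜 :=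
  Matrix.det (Matrix.of fun i j : Fin r => c.inner (x i) (x j))

variable (c : InnerProductSpace.Core 𝕜 V)

theorem form_add_right (x y z : V) : c.inner x (y + z) = c.inner x y + c.inner x z := by
  rw [← c.conj_inner_symm, c.add_left, map_add, c.conj_inner_symm, c.conj_inner_symm]

theorem form_smul_right (x y : V) (a : 𝕜) : c.inner x (a • y) = a * c.inner x y := by
  rw [← c.conj_inner_symm, c.smul_left, map_mul, c.conj_inner_symm, RCLike.conj_conj]

theorem form_sum_left {ι : Type*} (s : Finset ι) (x : ι → V) (y : V) :
    c.inner (∑ i ∈ s, x i) y = ∑ i ∈ s, c.inner (x i) y :=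
  map_sum (AddMonoidHom.mk' (fun x => c.inner x y) fun a b => c.add_left a b y) x s

theorem form_sum_right {ι : Type*} (s : Finset ι) (x : V) (y : ι → V) :
    c.inner x (∑ i ∈ s, y i) = ∑ i ∈ s, c.inner x (y i) :=
  map_sum (AddMonoidHom.mk' (fun y => c.inner x y) fun a b => form_add_right c x a b) y s

theorem form_sub_right (x y z : V) : c.inner x (y - z) = c.inner x y - c.inner x z :=
  map_sub (AddMonoidHom.mk' (fun y => c.inner x y) fun a b => form_add_right c x a b) y z

theorem form_self_re (x : V) : ((RCLike.re (c.inner x x) : ℝ) : 𝕜) = c.inner x x :=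
  RCLike.conj_eq_iff_re.1 (c.conj_inner_symm x x)

/-- The change of basis formula for Gram determinants. -/
theorem gramDet_linearCombination {r : ℕ} (x : Fin r → V) (A : Matrix (Fin r) (Fin r) 𝕜) :
    gramDet c (fun j => ∑ i, A i j • x i) = ((‖A.det‖ ^ 2 : ℝ) : 𝕜) * gramDet c x := by
  have : Matrix.of (fun i j : Fin r => c.inner (∑ k, A k i • x k) (∑ l, A l j • x l)) =
      A.conjTranspose * Matrix.of (fun i j : Fin r => c.inner (x i) (x j)) * A := by
    ext i j
    simp only [Matrix.of_apply, Matrix.mul_apply, form_sum_left, form_sum_right, c.smul_left,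
      form_smul_right, Matrix.conjTranspose_apply, Finset.sum_mul, Finset.mul_sum, RCLike.star_def]
    exact Finset.sum_congr rfl fun l _ => Finset.sum_congr rfl fun k _ => by ring
  rw [gramDet, this, Matrix.det_mul, Matrix.det_mul, Matrix.det_conjTranspose, gramDet,
    mul_right_comm, RCLike.star_def, RCLike.conj_mul]
  push_cast
  ring

theorem gramDet_pos {r : ℕ} {x : Fin r → V} (hx : LinearIndependent 𝕜 x) :
    0 < RCLike.re (gramDet c x) := by
  let : NormedAddCommGroup V := c.toNormedAddCommGroup
  let : InnerProductSpace 𝕜 V := InnerProductSpace.ofCore c.toCore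
  have h := (Matrix.posDef_gram_of_linearIndependent hx).det_pos
  exact (RCLike.pos_iff.1 h).1

/-- The Gram determinant of `(d, f_1, …, f_k)` is `⟨d, d⟩` times the Gram determinant of the
orthogonal projections of `f_1, …, f_k` to the complement of `d`. -/
theorem gramDet_cons {k : ℕ} (d : V) (f : Fin k → V) (a : Fin k → 𝕜)
    (h : ∀ i, c.inner d (f i - a i • d) = 0) :
    gramDet c (Fin.cons d f : Fin (k + 1) → V) =
      c.inner d d * gramDet c fun i => f i - a i • d := by
  have h' : ∀ i, c.inner (f i - a i • d) d = 0 := fun i => by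
    rw [← c.conj_inner_symm, h, map_zero]
  -- the unitriangular matrix `A` expresses `(d, f_i)` in terms of `(d, f_i - a_i d)`
  let g : Fin (k + 1) → V := Fin.cons d fun i => f i - a i • d
  let A : Matrix (Fin (k + 1)) (Fin (k + 1)) 𝕜 :=
    Fin.cons (Fin.cons 1 a) fun i => Fin.cons 0 fun j => if i = j then 1 else 0
  have hA : A.det = 1 := by
    rw [Matrix.det_of_isUpperTriangular]
    · rw [Fin.prod_univ_succ]; simp [A]
    · intro i j hij
      refine Fin.cases (fun hij => ?_) (fun i hij => ?_) i hij
      · exact absurd hij (Fin.not_lt_zero _)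
      · refine Fin.cases (fun _ => by simp [A]) (fun j hij => ?_) j hij
        have : i ≠ j := by
          rintro rfl; exact lt_irrefl _ hij
        simp [A, this]
  have hg : (Fin.cons d f : Fin (k + 1) → V) = fun j => ∑ i, A i j • g i := by
    ext j
    rw [Fin.sum_univ_succ]
    refine Fin.cases ?_ (fun j => ?_) j
    · simp [A, g]
    · simp [A, g, ite_smul]
  rw [hg, gramDet_linearCombination, hA, gramDet, Matrix.det_succ_column_zero, Fin.sum_univ_succ]
  simp [g, h', gramDet, Matrix.submatrix]

theorem gramDet_rescale {r : ℕ} {V' : Type*} [AddCommGroup V'] [Module 𝕜 V']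
    (c' : InnerProductSpace.Core 𝕜 V') (x : Fin r → V) (y : Fin r → V') (a : 𝕜)
    (h : ∀ i j, c'.inner (y i) (y j) = a * c.inner (x i) (x j)) :
    gramDet c' y = a ^ r * gramDet c x := by
  have : Matrix.of (fun i j : Fin r => c'.inner (y i) (y j)) =
      a • Matrix.of (fun i j : Fin r => c.inner (x i) (x j)) := by
    ext i j; simp [h]
  rw [gramDet, this, Matrix.det_smul, Fintype.card_fin, gramDet]

end Gram

/-! ### Independence of the arithmetic degree of the basis -/

section ProductFormula

variable {K : Type*} [Field K] [NumberField K]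

theorem finite_support_log_adicAbv {a : K} (ha : a ≠ 0) :
    (Function.support fun v : HeightOneSpectrum (𝓞 K) =>
      Real.log (HeightOneSpectrum.adicAbv K v a)).Finite := by
  have h := (FinitePlace.hasFiniteMulSupport ha).preimage
    (f := FinitePlace.equivHeightOneSpectrum.symm)
    FinitePlace.equivHeightOneSpectrum.symm.injective.injOn
  refine h.subset fun v hv => ?_
  simp only [Set.mem_preimage, Function.mem_mulSupport,
    FinitePlace.equivHeightOneSpectrum_symm_apply, FinitePlace.norm_embedding]
  intro h
  exact hv (by simp [h])

theorem norm_algebraMap_completion (w : InfinitePlace K) (a : K) :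
    ‖algebraMap K w.Completion a‖ = w a := by
  exact InfinitePlace.Completion.norm_coe w _

/-- The product formula in additive form. -/
theorem finsum_log_adicAbv_add {a : K} (ha : a ≠ 0) :
    ∑ᶠ v : HeightOneSpectrum (𝓞 K), Real.log (HeightOneSpectrum.adicAbv K v a) +
      ∑ w : InfinitePlace K, w.mult * Real.log (w a) = 0 := by
  have h := prod_abs_eq_one ha
  rw [← finprod_comp_equiv FinitePlace.equivHeightOneSpectrum.symm] at h
  simp only [FinitePlace.equivHeightOneSpectrum_symm_apply, FinitePlace.norm_embedding] at h
  have hfin : (Function.mulSupport fun v : HeightOneSpectrum (𝓞 K) =>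
      HeightOneSpectrum.adicAbv K v a).Finite := by
    refine (finite_support_log_adicAbv ha).subset fun v hv => ?_
    have := (AbsoluteValue.pos_iff (HeightOneSpectrum.adicAbv K v)).2 ha
    exact Real.log_ne_zero_of_pos_of_ne_one this hv
  have h2 : ∀ w ∈ (Finset.univ : Finset (InfinitePlace K)), w a ^ w.mult ≠ 0 := fun w _ =>
    pow_ne_zero _ (by simpa using ha)
  have h3 : ∀ v ∈ hfin.toFinset, HeightOneSpectrum.adicAbv K v a ≠ 0 := fun v _ => by simpa using ha
  rw [finprod_eq_prod _ hfin] at h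
  have h := congrArg Real.log h
  rw [Real.log_mul (Finset.prod_ne_zero_iff.2 h2) (Finset.prod_ne_zero_iff.2 h3),
    Real.log_prod h2, Real.log_prod h3, Real.log_one] at h
  rw [finsum_eq_sum_of_support_subset (s := hfin.toFinset)]
  · rw [add_comm, ← h]
    simp [Real.log_pow]
  · intro v hv
    rw [Set.Finite.coe_toFinset]
    intro hv1
    exact hv (by simp only [hv1, Real.log_one])

end ProductFormula

namespace AdelicSpace

open Module

variable {K E : Type*} [Field K] [NumberField K] [AddCommGroup E] [Module K E]
  [Module (𝓞 K) E] [IsScalarTower (𝓞 K) K E]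

/-- The Gram determinant of `x_1, …, x_r` at an archimedean place. -/
def archGram (A : AdelicSpace K E) (w : InfinitePlace K) {r : ℕ} (x : Fin r → E) : ℝ :=
  letI := completionRCLike w
  RCLike.re (gramDet (A.form w) fun i => (1 : w.Completion) ⊗ₜ[K] x i)

/-- The `v`-adic norm of `x_1 ∧ ⋯ ∧ x_r`. -/
def locNorm (A : AdelicSpace K E) (v : HeightOneSpectrum (𝓞 K)) {r : ℕ} (x : Fin r → E) : ℝ :=
  finNorm (extLattice A.lattice r) v (exteriorPower.ιMulti K r x)

variable (A : AdelicSpace K E)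

theorem archNorm_eq (w : InfinitePlace K) {r : ℕ} (x : Fin r → E) :
    A.archNorm w x = √(A.archGram w x) ^ w.mult := rfl

theorem archGram_pos (w : InfinitePlace K) {r : ℕ} (x : Basis (Fin r) K E) :
    0 < A.archGram w x := by
  let := completionRCLike w
  refine gramDet_pos (A.form w) ?_
  have h := (x.baseChange w.Completion).linearIndependent
  rwa [show ⇑(x.baseChange w.Completion) = fun i => (1 : w.Completion) ⊗ₜ[K] x i from
    funext fun i => x.baseChange_apply w.Completion i] at h

theorem log_archNorm (w : InfinitePlace K) {r : ℕ} (x : Basis (Fin r) K E) :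
    Real.log (A.archNorm w x) = w.mult * (Real.log (A.archGram w x) / 2) := by
  rw [archNorm_eq, Real.log_pow, Real.log_sqrt (A.archGram_pos w x).le]

theorem archGram_linearCombination (w : InfinitePlace K) {r : ℕ} (x : Fin r → E)
    (B : Matrix (Fin r) (Fin r) K) :
    A.archGram w (fun j => ∑ i, B i j • x i) = w B.det ^ 2 * A.archGram w x := by
  let := completionRCLike w
  have h : (fun j => (1 : w.Completion) ⊗ₜ[K] ∑ i, B i j • x i) = fun j =>
      ∑ i, (algebraMap K w.Completion).mapMatrix B i j • ((1 : w.Completion) ⊗ₜ[K] x i) := by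
    ext j
    rw [TensorProduct.tmul_sum]
    refine Finset.sum_congr rfl fun i _ => ?_
    rw [TensorProduct.tmul_smul, RingHom.mapMatrix_apply, Matrix.map_apply, algebraMap_smul]
  rw [archGram, h, gramDet_linearCombination, ← RingHom.map_det, RCLike.re_ofReal_mul]
  congr 2
  exact norm_algebraMap_completion w _

theorem archGram_basis (w : InfinitePlace K) {r : ℕ} (x : Basis (Fin r) K E) (x' : Fin r → E) :
    A.archGram w x' = w (x.det x') ^ 2 * A.archGram w x := by
  rw [x.det_apply, ← archGram_linearCombination]
  congr 1
  ext j
  rw [x.sum_toMatrix_smul_self]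

theorem locNorm_pos (v : HeightOneSpectrum (𝓞 K)) {r : ℕ} (x : Basis (Fin r) K E) :
    0 < A.locNorm v x := finNorm_pos A.isLattice x

theorem locNorm_basis (v : HeightOneSpectrum (𝓞 K)) {r : ℕ} (x x' : Basis (Fin r) K E) :
    A.locNorm v x' = HeightOneSpectrum.adicAbv K v (x.det x') * A.locNorm v x :=
  finNorm_basis A.isLattice x x'

theorem finite_support_log_locNorm {r : ℕ} (x : Basis (Fin r) K E) :
    (Function.support fun v => Real.log (A.locNorm v x)).Finite := by
  refine (finite_finNorm_ne_one A.isLattice x).subset fun v hv h => hv ?_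
  beta_reduce
  rw [locNorm, h, Real.log_one]

theorem degWith_eq {r : ℕ} (x : Basis (Fin r) K E) :
    A.degWith x = -(∑ᶠ v, Real.log (A.locNorm v x) +
      ∑ w : InfinitePlace K, w.mult * (Real.log (A.archGram w x) / 2)) := by
  simp only [← log_archNorm]
  rfl

theorem degWith_basis {r : ℕ} (x x' : Basis (Fin r) K E) : A.degWith x' = A.degWith x := by
  have hd : x.det x' ≠ 0 := (x.isUnit_det x').ne_zero
  have h1 : ∀ v, Real.log (A.locNorm v x') =
      Real.log (HeightOneSpectrum.adicAbv K v (x.det x')) + Real.log (A.locNorm v x) := fun v => by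
    rw [A.locNorm_basis, Real.log_mul _ (A.locNorm_pos v x).ne']
    simpa using hd
  have h2 : ∀ w : InfinitePlace K, w.mult * (Real.log (A.archGram w x') / 2) =
      w.mult * Real.log (w (x.det x')) + w.mult * (Real.log (A.archGram w x) / 2) := fun w => by
    have hw : w (x.det x') ≠ 0 := by simpa using hd
    rw [A.archGram_basis w x x', Real.log_mul (pow_ne_zero 2 hw)
      (A.archGram_pos w x).ne', Real.log_pow]
    push_cast
    ring
  rw [degWith_eq, degWith_eq]
  simp only [h1, h2]
  rw [finsum_add_distrib (finite_support_log_adicAbv hd) (A.finite_support_log_locNorm x),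
    Finset.sum_add_distrib]
  linarith [finsum_log_adicAbv_add hd]

/-- The arithmetic degree may be computed with any basis. -/
theorem deg_eq [FiniteDimensional K E] {r : ℕ} (x : Basis (Fin r) K E) : A.deg = A.degWith x := by
  obtain rfl : r = finrank K E := by rw [finrank_eq_card_basis x, Fintype.card_fin]
  exact A.degWith_basis x _

end AdelicSpace

/-! ### Bases adapted to a line -/

section ConsBasis

open Module

variable {K V W : Type*} [Field K] [AddCommGroup V] [Module K V] [AddCommGroup W] [Module K W]

section
variable {p : V →ₗ[K] W} {d : V} (hd : d ≠ 0) (hp : ∀ y, p y = 0 ↔ ∃ c : K, c • d = y) {k : ℕ}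
  {f : Fin k → V} {t : Basis (Fin k) K W} (hf : ∀ i, p (f i) = t i)

/-- If the kernel of `p` is the line spanned by `d` and `f` lifts a basis of the target of `p`, then
`(d, f_1, …, f_k)` is a basis. -/
def consBasis : Basis (Fin (k + 1)) K V :=
  have key : ∀ c : Fin k → K, p (∑ i, c i • f i) = ∑ i, c i • t i := fun c => by
    simp [map_sum, hf]
  Basis.mk (v := (Fin.cons d f : Fin (k + 1) → V))
    (by
      rw [Fintype.linearIndependent_iff]
      intro c hc
      rw [Fin.sum_univ_succ] at hc
      simp only [Fin.cons_zero, Fin.cons_succ] at hc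
      have hpd : p d = 0 := (hp d).2 ⟨1, one_smul _ _⟩
      have h := congrArg p hc
      rw [map_add, map_smul, hpd, smul_zero, zero_add, key, map_zero] at h
      have h1 := Fintype.linearIndependent_iff.1 t.linearIndependent _ h
      refine Fin.cases ?_ h1
      simpa [h1, hd] using hc)
    (by
      intro y _
      obtain ⟨c, hc⟩ := (hp (y - ∑ i, t.repr (p y) i • f i)).1 (by
        rw [map_sub, key, t.sum_repr, sub_self])
      rw [eq_sub_iff_add_eq] at hc
      rw [← hc]
      refine Submodule.add_mem _ (Submodule.smul_mem _ _ (Submodule.subset_span ⟨0, rfl⟩))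
        (Submodule.sum_mem _ fun i _ => Submodule.smul_mem _ _ (Submodule.subset_span ⟨i.succ, rfl⟩)))

theorem coe_consBasis : ⇑(consBasis hd hp hf) = (Fin.cons d f : Fin (k + 1) → V) := by
  rw [consBasis, Basis.coe_mk]

theorem consBasis_repr_succ (y : V) (i : Fin k) :
    (consBasis hd hp hf).repr y i.succ = t.repr (p y) i := by
  have hpd : p d = 0 := (hp d).2 ⟨1, one_smul _ _⟩
  have h := congrArg (fun z => t.repr (p z) i) ((consBasis hd hp hf).sum_repr y)
  simp only [Fin.sum_univ_succ, coe_consBasis, Fin.cons_zero, Fin.cons_succ, map_add, map_smul, hpd,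
    smul_zero, zero_add, map_sum, hf] at h
  rw [← h]
  simp only [← map_smul, ← map_sum]
  rw [map_sum]
  simp [Finsupp.single_apply]

end

theorem consBasis_det {p : V →ₗ[K] W} {d : V} (hd : d ≠ 0)
    (hp : ∀ y, p y = 0 ↔ ∃ c : K, c • d = y) {c : K} (hc : c ≠ 0)
    (hp' : ∀ y, p y = 0 ↔ ∃ b : K, b • c • d = y)
    {k : ℕ} {f g : Fin k → V} {t u : Basis (Fin k) K W}
    (hf : ∀ i, p (f i) = t i) (hg : ∀ i, p (g i) = u i) :
    (consBasis (smul_ne_zero hc hd) hp' hg).det (consBasis hd hp hf) = c⁻¹ * u.det t := by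
  have hpd : p d = 0 := (hp d).2 ⟨1, one_smul _ _⟩
  rw [Basis.det_apply, Matrix.det_succ_column_zero, Fin.sum_univ_succ, Finset.sum_eq_zero]
  · rw [add_zero, Basis.det_apply]
    have h0 : (consBasis (smul_ne_zero hc hd) hp' hg).toMatrix (consBasis hd hp hf) 0 0 = c⁻¹ := by
      have h : c • d = (consBasis (smul_ne_zero hc hd) hp' hg) 0 := by
        rw [coe_consBasis, Fin.cons_zero]
      have h := congrArg (fun y => (consBasis (smul_ne_zero hc hd) hp' hg).repr y 0) h
      simp only [map_smul, Basis.repr_self, Finsupp.smul_apply, Finsupp.single_eq_same,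
        smul_eq_mul] at h
      rw [Basis.toMatrix_apply, coe_consBasis hd hp hf, Fin.cons_zero]
      exact eq_inv_of_mul_eq_one_right h
    rw [h0]
    have : ((consBasis (smul_ne_zero hc hd) hp' hg).toMatrix (consBasis hd hp hf)).submatrix
        (Fin.succAbove 0) Fin.succ = u.toMatrix t := by
      ext i j
      rw [Matrix.submatrix_apply, Fin.succAbove_zero, Basis.toMatrix_apply, consBasis_repr_succ,
        coe_consBasis, Fin.cons_succ, hf, Basis.toMatrix_apply]
    rw [this]
    simp
  · intro i _
    rw [Basis.toMatrix_apply, consBasis_repr_succ, coe_consBasis, Fin.cons_zero, hpd]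
    simp

end ConsBasis

/-! ### The quotient map from a vector space to the tangent space -/

section TangentMap

open Module

variable {K E : Type*} [Field K] [AddCommGroup E] [Module K E] (P : ℙ K E)

/-- The coordinate on the line of `P` with respect to `lineVector P`. -/
def lineCoord : P.submodule ≃ₗ[K] K :=
  (LinearEquiv.ofEq _ _ P.submodule_eq).trans (LinearEquiv.coord K E P.rep P.rep_nonzero)

theorem lineCoord_lineVector : lineCoord P (lineVector P) = 1 :=
  LinearEquiv.coord_self K E P.rep P.rep_nonzero

/-- The basis of the line of `P` given by `lineVector P`. -/
def lineBasis : Basis (Fin 1) K P.submodule := (Basis.singleton (Fin 1) K).map (lineCoord P).symm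

theorem lineBasis_apply (i : Fin 1) : lineBasis P i = lineVector P := by
  rw [lineBasis, Basis.map_apply, Basis.singleton_apply, LinearEquiv.symm_apply_eq,
    lineCoord_lineVector]

/-- The linear map `E → Hom(D, E)` (an isomorphism) sending `y` to the map with value `y` at
`lineVector P`. -/
def homOf : E →ₗ[K] (P.submodule →ₗ[K] E) :=
  LinearMap.smulRightₗ (lineCoord P).toLinearMap

theorem homOf_apply (y : E) : homOf P y (lineVector P) = y := by
  simp [homOf, lineCoord_lineVector]

theorem homOf_eval (φ : P.submodule →ₗ[K] E) : homOf P (φ (lineVector P)) = φ :=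
  eval_injective P (lineVector_ne_zero P) (homOf_apply P _)

theorem mem_homSelf {φ : P.submodule →ₗ[K] E} :
    φ ∈ homSelf P ↔ φ (lineVector P) ∈ P.submodule := by
  constructor
  · rintro ⟨ψ, rfl⟩
    exact (ψ (lineVector P)).2
  · intro h
    refine ⟨(lineCoord P).toLinearMap.smulRight ⟨_, h⟩, ?_⟩
    refine eval_injective P (lineVector_ne_zero P) ?_
    simp [lineCoord_lineVector]

/-- The surjection `E → T_P ℙ(E)` with kernel `D` obtained by trivializing `D` by
`lineVector P`. -/
def tangentMap : E →ₗ[K] TangentSpace P := (homSelf P).mkQ ∘ₗ homOf P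

theorem tangentMap_eval (φ : P.submodule →ₗ[K] E) :
    tangentMap P (φ (lineVector P)) = (homSelf P).mkQ φ := by
  rw [tangentMap, LinearMap.comp_apply, homOf_eval]

theorem tangentMap_surjective : Function.Surjective (tangentMap P) := fun z => by
  obtain ⟨φ, rfl⟩ := (homSelf P).mkQ_surjective z
  exact ⟨_, tangentMap_eval P φ⟩

theorem tangentMap_eq_zero {y : E} : tangentMap P y = 0 ↔ y ∈ P.submodule := by
  rw [tangentMap, LinearMap.comp_apply, Submodule.mkQ_apply, Submodule.Quotient.mk_eq_zero,
    mem_homSelf, homOf_apply]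

/-- The restriction of `tangentMap` to a subspace. -/
def tangentMapOn (F : Submodule K E) : F →ₗ[K] F.map (tangentMap P) :=
  (tangentMap P).restrict fun _ h => Submodule.mem_map_of_mem h

theorem tangentMapOn_surjective (F : Submodule K E) : Function.Surjective (tangentMapOn P F) := by
  rintro ⟨_, y, hy, rfl⟩
  exact ⟨⟨y, hy⟩, rfl⟩

theorem tangentMapOn_eq_zero {F : Submodule K E} (hF : P.submodule ≤ F) {c : K} (hc : c ≠ 0)
    (y : F) : tangentMapOn P F y = 0 ↔
      ∃ b : K, b • c • (⟨lineVector P, hF (lineVector P).2⟩ : F) = y := by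
  rw [← Subtype.coe_inj]
  change tangentMap P y = 0 ↔ _
  rw [tangentMap_eq_zero]
  constructor
  · intro h
    obtain ⟨b, hb⟩ := exists_smul_lineVector P ⟨y, h⟩
    refine ⟨b * c⁻¹, Subtype.ext ?_⟩
    rw [smul_smul, mul_assoc, inv_mul_cancel₀ hc, mul_one]
    exact congrArg (fun z : P.submodule => (z : E)) hb
  · rintro ⟨b, rfl⟩
    exact Submodule.smul_mem _ _ (Submodule.smul_mem _ _ (lineVector P).2)

end TangentMap

/-! ### Local bases of the tangent space -/

namespace AdelicSpace

open Module

variable {K E : Type*} [Field K] [NumberField K] [AddCommGroup E] [Module K E]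
  [Module (𝓞 K) E] [IsScalarTower (𝓞 K) K E] (A : AdelicSpace K E)
  {v : HeightOneSpectrum (𝓞 K)}

theorem mem_localization_restrict {F : Submodule K E} {y : F} :
    y ∈ localization v (A.restrict F).lattice ↔ (y : E) ∈ localization v A.lattice := Iff.rfl

theorem mem_localization_quotient {F : Submodule K E} {z : E ⧸ F} :
    z ∈ localization v (A.quotient F).lattice ↔ ∃ y ∈ localization v A.lattice, F.mkQ y = z := by
  constructor
  · rintro ⟨s, hs, m, hm, hmz⟩
    have hs' : algebraMap (𝓞 K) K s ≠ 0 := ne_zero_of_mem_primeCompl hs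
    refine ⟨(algebraMap (𝓞 K) K s)⁻¹ • m, ⟨s, hs, ?_⟩, ?_⟩
    · rwa [← algebraMap_smul K s, smul_smul, mul_inv_cancel₀ hs', one_smul]
    · have hmz : F.mkQ m = s • z := hmz
      rw [map_smul, hmz, ← algebraMap_smul K s, smul_smul, inv_mul_cancel₀ hs', one_smul]
  · rintro ⟨y, ⟨s, hs, hsy⟩, rfl⟩
    exact ⟨s, hs, s • y, hsy, rfl⟩

/-- If `e` generates the localization of `Λ ∩ D`, a map `D → E` is in the localization of the lattice
of `D^∨ ⊗ E` if and only if it sends `e` to the localization of `Λ`. -/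
theorem mem_localization_homLine {P : ℙ K E} {e : Basis (Fin 1) K P.submodule}
    (he : IsLocalBasis v (A.restrict P.submodule).lattice e) {φ : P.submodule →ₗ[K] E} :
    φ ∈ localization v (A.homLine P).lattice ↔ φ (e 0) ∈ localization v A.lattice := by
  constructor
  · rintro ⟨s, hs, h⟩
    obtain ⟨t, ht, hte⟩ := he.mem 0
    refine ⟨s * t, mul_mem hs ht, ?_⟩
    have := h (t • e 0) hte
    rw [LinearMap.smul_apply, ← algebraMap_smul K t, map_smul, algebraMap_smul] at this
    rwa [mul_smul]
  · intro h
    obtain ⟨S, hS⟩ := (A.restrict P.submodule).isLattice.fg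
    have h1 : ∀ y : S, ∃ s ∈ v.asIdeal.primeCompl, s • φ y ∈ A.lattice := by
      rintro ⟨y, hy⟩
      have hy' : y ∈ localization v (A.restrict P.submodule).lattice :=
        le_localization (hS ▸ Submodule.subset_span hy)
      have h2 := (he y).1 hy' 0
      change φ y ∈ localization v A.lattice
      rw [← e.sum_repr y, Fin.sum_univ_one, map_smul]
      exact smul_mem_localization h2 h
    obtain ⟨s, hs, hsS⟩ := exists_common_smul_mem A.lattice v.asIdeal.primeCompl
      (fun y : S => φ y) h1
    refine ⟨s, hs, fun x hx => ?_⟩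
    have hx' : x ∈ Submodule.span (𝓞 K) (S : Set P.submodule) := by rw [hS]; exact hx
    have hle : Submodule.span (𝓞 K) (S : Set P.submodule) ≤
        A.lattice.comap ((s • φ).restrictScalars (𝓞 K)) :=
      Submodule.span_le.2 fun z hz => hsS ⟨z, hz⟩
    exact hle hx'

/-- If `c d` generates the localization of `Λ ∩ D`, the localized lattice of `T_F` is `c⁻¹` times the
image of the localized lattice of `F`. -/
theorem mem_localization_tangent {P : ℙ K E} {e : Basis (Fin 1) K P.submodule}
    (he : IsLocalBasis v (A.restrict P.submodule).lattice e) {c : K} (hc : c ≠ 0)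
    (hec : c • lineVector P = e 0) {F : Submodule K E} (hF : P.submodule ≤ F)
    {z : F.map (tangentMap P)} :
    z ∈ localization v ((A.tangent P).restrict (F.map (tangentMap P))).lattice ↔
      ∃ y ∈ localization v (A.restrict F).lattice, tangentMapOn P F y = c • z := by
  rw [mem_localization_restrict]
  unfold tangent
  rw [mem_localization_quotient]
  constructor
  · rintro ⟨φ, hφ, hz⟩
    rw [mem_localization_homLine A he, ← hec, map_smul] at hφ
    have hFφ : φ (lineVector P) ∈ F := by
      obtain ⟨y, hy, hyz⟩ := z.2
      have : φ (lineVector P) - y ∈ P.submodule := by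
        rw [← tangentMap_eq_zero, map_sub, tangentMap_eval, hz, hyz, sub_self]
      rw [← sub_add_cancel (φ (lineVector P)) y]
      exact F.add_mem (hF this) hy
    refine ⟨⟨c • φ (lineVector P), F.smul_mem c hFφ⟩, hφ, Subtype.ext ?_⟩
    change tangentMap P (c • φ (lineVector P)) = c • (z : TangentSpace P)
    rw [map_smul, tangentMap_eval, hz]
  · rintro ⟨y, hy, hyz⟩
    refine ⟨homOf P (c⁻¹ • (y : E)), ?_, ?_⟩
    · rw [mem_localization_homLine A he, ← hec, map_smul, homOf_apply, smul_smul,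
        mul_inv_cancel₀ hc, one_smul]
      exact hy
    · have hyz : tangentMap P y = c • (z : TangentSpace P) := congrArg Subtype.val hyz
      change tangentMap P (c⁻¹ • (y : E)) = z
      rw [map_smul, hyz, smul_smul, inv_mul_cancel₀ hc, one_smul]

/-- The comparison of local norms behind `deg (T_F) = deg F - (dim F) deg D`. -/
theorem locNorm_tangent (v : HeightOneSpectrum (𝓞 K)) {P : ℙ K E} {F : Submodule K E}
    (hF : P.submodule ≤ F) {k : ℕ} (t : Basis (Fin k) K (F.map (tangentMap P)))
    (x : Basis (Fin (k + 1)) K F) {f : Fin k → F} (hf : ∀ i, tangentMapOn P F (f i) = t i)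
    (hx : ⇑x = (Fin.cons ⟨lineVector P, hF (lineVector P).2⟩ f : Fin (k + 1) → F)) :
    (A.restrict F).locNorm v x = ((A.tangent P).restrict (F.map (tangentMap P))).locNorm v t *
      (A.restrict P.submodule).locNorm v (lineBasis P) ^ (k + 1) := by
  set d : F := ⟨lineVector P, hF (lineVector P).2⟩ with hd_def
  have hd : d ≠ 0 := fun h => lineVector_ne_zero P (Subtype.ext (congrArg (fun z : F => (z : E)) h))
  obtain ⟨e, he⟩ := exists_isLocalBasis (v := v) (A.restrict P.submodule).isLattice (lineBasis P)
  obtain ⟨c, hec⟩ := exists_smul_lineVector P (e 0)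
  have hc : c ≠ 0 := by
    rintro rfl
    exact e.ne_zero 0 (by rw [← hec, zero_smul])
  obtain ⟨u, hu⟩ := exists_isLocalBasis (v := v)
    ((A.tangent P).restrict (F.map (tangentMap P))).isLattice t
  have hg : ∀ i, ∃ y ∈ localization v (A.restrict F).lattice, tangentMapOn P F y = c • u i :=
    fun i => (A.mem_localization_tangent he hc hec hF).1 (hu.mem i)
  choose g hgM hg using hg
  -- `c d` and lifts of `c u_1, …, c u_k` to the localization of `Λ ∩ F` form a local basis of `F`
  let u' : Basis (Fin k) K (F.map (tangentMap P)) := u.map (LinearEquiv.smulOfNeZero K _ c hc)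
  have hg' : ∀ i, tangentMapOn P F (g i) = u' i := fun i => by
    rw [hg, Basis.map_apply, LinearEquiv.smulOfNeZero_apply]
  have hp1 := tangentMapOn_eq_zero P hF (one_ne_zero (α := K))
  simp only [one_smul] at hp1
  have hpc := tangentMapOn_eq_zero P hF hc
  let b := consBasis (smul_ne_zero hc hd) hpc hg'
  have hb0 : c • d ∈ localization v (A.restrict F).lattice := by
    rw [mem_localization_restrict]
    have : ((c • d : F) : E) = (e 0 : P.submodule) := congrArg Subtype.val hec
    rw [this]
    exact he.mem 0
  have hb : IsLocalBasis v (A.restrict F).lattice b := by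
    refine isLocalBasis_of ?_ fun y hy => ?_
    · refine Fin.cases ?_ fun i => ?_
      · rw [coe_consBasis]; exact hb0
      · rw [coe_consBasis]; exact hgM i
    · have hsucc : ∀ i : Fin k, HeightOneSpectrum.adicAbv K v (b.repr y i.succ) ≤ 1 := fun i => by
        rw [consBasis_repr_succ]
        have h1 : c⁻¹ • tangentMapOn P F y ∈
            localization v ((A.tangent P).restrict (F.map (tangentMap P))).lattice :=
          (A.mem_localization_tangent he hc hec hF).2 ⟨y, le_localization hy, by
            rw [smul_smul, mul_inv_cancel₀ hc, one_smul]⟩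
        have h2 := (hu _).1 h1 i
        have h3 : u'.repr (tangentMapOn P F y) i = u.repr (c⁻¹ • tangentMapOn P F y) i := rfl
        rwa [h3]
      refine Fin.cases ?_ hsucc
      have h1 : b.repr y 0 • (c • d) ∈ localization v (A.restrict F).lattice := by
        have := b.sum_repr y
        rw [Fin.sum_univ_succ, ← eq_sub_iff_add_eq] at this
        have hb0' : b 0 = c • d := by rw [coe_consBasis]; rfl
        rw [← hb0', this]
        refine Submodule.sub_mem _ (le_localization hy) (Submodule.sum_mem _ fun i _ =>
          smul_mem_localization (hsucc i) ?_)
        rw [coe_consBasis]; exact hgM i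
      have h2 : b.repr y 0 • e 0 ∈ localization v (A.restrict P.submodule).lattice := by
        rw [← hec]; exact h1
      have h3 := (he _).1 h2 0
      rwa [map_smul, e.repr_self, Finsupp.smul_apply, Finsupp.single_eq_same, smul_eq_mul,
        mul_one] at h3
  have hxe : ⇑x = consBasis hd hp1 hf := by rw [hx, coe_consBasis]
  have hlb : e.det (lineBasis P) = c⁻¹ := by
    rw [Basis.det_apply, Matrix.det_fin_one, Basis.toMatrix_apply, lineBasis_apply]
    have : lineVector P = c⁻¹ • e 0 := by rw [← hec, smul_smul, inv_mul_cancel₀ hc, one_smul]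
    rw [this, map_smul, e.repr_self]
    simp
  have hu't : u'.det t = (c⁻¹) ^ k * u.det t := by
    rw [Basis.det_map]
    have : (LinearEquiv.smulOfNeZero K (F.map (tangentMap P)) c hc).symm ∘ t =
        fun i => (fun _ : Fin k => c⁻¹) i • t i := rfl
    rw [this, AlternatingMap.map_smul_univ, Finset.prod_const, Finset.card_univ, Fintype.card_fin,
      smul_eq_mul]
  rw [locNorm, locNorm, locNorm, finNorm_eq hb, finNorm_eq he, finNorm_eq hu, hlb, hxe,
    consBasis_det hd hp1 hc hpc hf hg', hu't, ← map_pow, ← map_mul]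
  congr 1
  ring

end AdelicSpace

/-! ### The hermitian forms of the tangent space -/

section QuotientForm

variable {𝕜 V W : Type*} [RCLike 𝕜] [AddCommGroup V] [Module 𝕜 V] [AddCommGroup W] [Module 𝕜 W]

/-- The quotient form may be computed with any lifts that are orthogonal to the kernel. -/
theorem quotientForm_inner [Module.Finite 𝕜 V] (c : InnerProductSpace.Core 𝕜 V)
    (p : V →ₗ[𝕜] W) (hp : Function.Surjective p) {y y' : V}
    (hy : ∀ x ∈ LinearMap.ker p, c.inner x y = 0) (hy' : ∀ x ∈ LinearMap.ker p, c.inner x y' = 0) :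
    (quotientForm c p hp).inner (p y) (p y') = c.inner y y' := by
  obtain ⟨hs, hso⟩ := (exists_orthogonal_section c p hp).choose_spec
  have key : ∀ y : V, (∀ x ∈ LinearMap.ker p, c.inner x y = 0) →
      (exists_orthogonal_section c p hp).choose (p y) = y := by
    intro y hy
    refine sub_eq_zero.1 (c.definite _ ?_)
    have hk : (exists_orthogonal_section c p hp).choose (p y) - y ∈ LinearMap.ker p := by
      rw [LinearMap.mem_ker, map_sub, hs, sub_self]
    rw [form_sub_right, hso _ _ hk, hy _ hk, sub_self]
  change c.inner _ _ = _
  rw [key y hy, key y' hy']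

end QuotientForm

namespace AdelicSpace

open Module

variable {K E : Type*} [Field K] [NumberField K] [AddCommGroup E] [Module K E]
  [Module (𝓞 K) E] [IsScalarTower (𝓞 K) K E] (A : AdelicSpace K E)

theorem restrict_inner (F : Submodule K E) (w : InfinitePlace K) (x y : F) :
    ((A.restrict F).form w).inner (1 ⊗ₜ[K] x) (1 ⊗ₜ[K] y) =
      (A.form w).inner (1 ⊗ₜ[K] (x : E)) (1 ⊗ₜ[K] (y : E)) := rfl

/-- After base change to `K_w`, the subspace `D^∨ ⊗ D` is still a line. -/
theorem ker_mkQ_baseChange (w : InfinitePlace K) (P : ℙ K E)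
    {z : w.Completion ⊗[K] (P.submodule →ₗ[K] E)}
    (hz : z ∈ LinearMap.ker ((homSelf P).mkQ.baseChange w.Completion)) :
    ∃ b : w.Completion, z = b • ((1 : w.Completion) ⊗ₜ[K] homOf P (lineVector P)) := by
  have hex : Function.Exact (homSelf P).subtype (homSelf P).mkQ := by
    rw [LinearMap.exact_iff, Submodule.ker_mkQ, Submodule.range_subtype]
  obtain ⟨z, rfl⟩ := (lTensor_exact w.Completion hex (homSelf P).mkQ_surjective z).1 hz
  induction z using TensorProduct.induction_on with
  | zero => exact ⟨0, by simp⟩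
  | add x y hx hy =>
    obtain ⟨a, ha⟩ := hx (by
      rw [LinearMap.mem_ker]; exact (lTensor_exact w.Completion hex (homSelf P).mkQ_surjective _).2
        ⟨x, rfl⟩)
    obtain ⟨b, hb⟩ := hy (by
      rw [LinearMap.mem_ker]; exact (lTensor_exact w.Completion hex (homSelf P).mkQ_surjective _).2
        ⟨y, rfl⟩)
    exact ⟨a + b, by rw [map_add, ha, hb, add_smul]⟩
  | tmul a φ =>
    obtain ⟨c, hc⟩ := exists_smul_lineVector P ⟨_, (mem_homSelf P).1 φ.2⟩
    have h : (φ : P.submodule →ₗ[K] E) = c • homOf P (lineVector P) := by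
      have h' : c • (lineVector P : E) = (φ : P.submodule →ₗ[K] E) (lineVector P) :=
        congrArg (fun z : P.submodule => (z : E)) hc
      rw [← map_smul, h', homOf_eval]
    refine ⟨a * algebraMap K _ c, ?_⟩
    rw [LinearMap.lTensor_tmul, Submodule.subtype_apply, h, TensorProduct.smul_tmul', smul_eq_mul,
      mul_one, ← TensorProduct.smul_tmul, Algebra.smul_def, mul_comm]

/-- Under the isomorphism `E ≃ Hom(D, E)` given by `lineVector P`, the form of `D^∨ ⊗ E` is the
form of `E` divided by its value at `lineVector P`. -/
theorem homLine_inner (P : ℙ K E) (w : InfinitePlace K) (x y : w.Completion ⊗[K] E) :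
    letI := completionRCLike w
    ((A.homLine P).form w).inner ((homOf P).baseChange w.Completion x)
      ((homOf P).baseChange w.Completion y) =
    (((RCLike.re ((A.form w).inner (1 ⊗ₜ[K] (lineVector P : E))
      (1 ⊗ₜ[K] (lineVector P : E))))⁻¹ : ℝ) : w.Completion) * (A.form w).inner x y := by
  have h : ∀ x : w.Completion ⊗[K] E,
      ((LinearMap.applyₗ (lineVector P) : (P.submodule →ₗ[K] E) →ₗ[K] E).baseChange w.Completion)
        ((homOf P).baseChange w.Completion x) = x := by
    intro x
    rw [← LinearMap.comp_apply, ← LinearMap.baseChange_comp]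
    have : (LinearMap.applyₗ (lineVector P) : (P.submodule →ₗ[K] E) →ₗ[K] E) ∘ₗ homOf P =
        LinearMap.id := LinearMap.ext fun y => homOf_apply P y
    rw [this, LinearMap.baseChange_id, LinearMap.id_apply]
  conv_rhs => rw [← h x, ← h y]
  rfl

/-- The archimedean comparison behind `deg (T_F) = deg F - (dim F) deg D`: both sides are computed
from the projections of `f_1, …, f_k` to the orthogonal complement of `D`. -/
theorem archGram_tangent (w : InfinitePlace K) {P : ℙ K E} {F : Submodule K E}
    (hF : P.submodule ≤ F) {k : ℕ} (t : Fin k → F.map (tangentMap P))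
    {f : Fin k → F} (hf : ∀ i, tangentMapOn P F (f i) = t i) :
    (A.restrict F).archGram w
        (Fin.cons ⟨lineVector P, hF (lineVector P).2⟩ f : Fin (k + 1) → F) =
      ((A.tangent P).restrict (F.map (tangentMap P))).archGram w t *
        (A.restrict P.submodule).archGram w (lineBasis P) ^ (k + 1) := by
  let := completionRCLike w
  let := A.finite
  let := (A.homLine P).finite
  -- `y i` is the lift of `t i` to `Hom(D, E)` that is orthogonal to `Hom(D, D)`; its value at
  -- `lineVector P` is `g i - a i • d`
  let d : w.Completion ⊗[K] E := 1 ⊗ₜ[K] (lineVector P : E)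
  let g : Fin k → w.Completion ⊗[K] E := fun i => 1 ⊗ₜ[K] (f i : E)
  let N : ℝ := RCLike.re ((A.form w).inner d d)
  have hN : (A.form w).inner d d = (N : w.Completion) := (form_self_re (A.form w) d).symm
  have hN0 : N ≠ 0 := (form_re_pos (A.form w)
    (one_tmul_ne_zero w fun h => lineVector_ne_zero P (Subtype.ext h))).ne'
  have hN0' : (N : w.Completion) ≠ 0 := RCLike.ofReal_ne_zero.2 hN0
  let a : Fin k → w.Completion := fun i => (A.form w).inner d (g i) / (N : w.Completion)
  have horth : ∀ i, (A.form w).inner d (g i - a i • d) = 0 := fun i => by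
    have h : (A.form w).inner d (a i • d) = a i * (A.form w).inner d d :=
      form_smul_right (A.form w) d d (a i)
    rw [form_sub_right, h, hN, div_mul_cancel₀ _ hN0', sub_self]
  let y : Fin k → w.Completion ⊗[K] (P.submodule →ₗ[K] E) := fun i =>
    (homOf P).baseChange w.Completion (g i - a i • d)
  have hy : ∀ i, ∀ x ∈ LinearMap.ker ((homSelf P).mkQ.baseChange w.Completion),
      ((A.homLine P).form w).inner x (y i) = 0 := by
    intro i x hx
    obtain ⟨b, rfl⟩ := ker_mkQ_baseChange w P hx
    have hd : (1 : w.Completion) ⊗ₜ[K] homOf P (lineVector P) =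
      (homOf P).baseChange w.Completion d := rfl
    rw [((A.homLine P).form w).smul_left, hd, homLine_inner, horth, mul_zero, mul_zero]
  have hyt : ∀ i, (homSelf P).mkQ.baseChange w.Completion (y i) =
      1 ⊗ₜ[K] (t i : TangentSpace P) := by
    intro i
    have h1 : (homSelf P).mkQ.baseChange w.Completion (y i) =
        (tangentMap P).baseChange w.Completion (g i - a i • d) := by
      rw [tangentMap, LinearMap.baseChange_comp]; rfl
    have h2 : tangentMap P (lineVector P : E) = 0 := (tangentMap_eq_zero P).2 (lineVector P).2
    rw [h1, map_sub, map_smul, LinearMap.baseChange_tmul, LinearMap.baseChange_tmul, h2,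
      TensorProduct.tmul_zero, smul_zero, sub_zero, ← hf]
    rfl
  have hT : ∀ i j, (((A.tangent P).restrict (F.map (tangentMap P))).form w).inner
      (1 ⊗ₜ[K] t i) (1 ⊗ₜ[K] t j) =
        ((N⁻¹ : ℝ) : w.Completion) * (A.form w).inner (g i - a i • d) (g j - a j • d) := by
    intro i j
    rw [restrict_inner, ← hyt, ← hyt]
    refine (quotientForm_inner ((A.homLine P).form w) _
      (LinearMap.lTensor_surjective w.Completion (homSelf P).mkQ_surjective) (hy i) (hy j)).trans ?_
    rw [homLine_inner]
  have e1 := gramDet_rescale (A.form w) (((A.tangent P).restrict (F.map (tangentMap P))).form w)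
    (fun i => g i - a i • d) (fun i => 1 ⊗ₜ[K] t i) _ hT
  have e2 := gramDet_cons (A.form w) d g a horth
  have e3 : (A.restrict F).archGram w
      (Fin.cons ⟨lineVector P, hF (lineVector P).2⟩ f : Fin (k + 1) → F) =
      RCLike.re (gramDet (A.form w) (Fin.cons d g : Fin (k + 1) → w.Completion ⊗[K] E)) := by
    have : (Fin.cons d g : Fin (k + 1) → w.Completion ⊗[K] E) = fun i =>
        1 ⊗ₜ[K] (((Fin.cons ⟨lineVector P, hF (lineVector P).2⟩ f : Fin (k + 1) → F) i : F) : E) := by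
      ext i
      refine Fin.cases rfl (fun i => rfl) i
    rw [this]
    rfl
  have e4 : (A.restrict P.submodule).archGram w (lineBasis P) = N := by
    rw [archGram, gramDet, Matrix.det_fin_one, Matrix.of_apply, lineBasis_apply]
    rfl
  rw [e3, e2, e4, archGram, e1, hN, ← RCLike.ofReal_pow, RCLike.re_ofReal_mul,
    RCLike.re_ofReal_mul, mul_right_comm, pow_succ, ← mul_assoc, ← mul_pow, inv_mul_cancel₀ hN0,
    one_pow, one_mul]

end AdelicSpace

/-! ### The arithmetic degree of subspaces of the tangent space -/

namespace AdelicSpace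

open Module

variable {K E : Type*} [Field K] [NumberField K] [AddCommGroup E] [Module K E]
  [Module (𝓞 K) E] [IsScalarTower (𝓞 K) K E] (A : AdelicSpace K E)

/-- The degree of the subspace `T_F` of the tangent space corresponding to `F ⊇ D`. -/
theorem deg_tangent_restrict [FiniteDimensional K E] {P : ℙ K E} {F : Submodule K E}
    (hF : P.submodule ≤ F) :
    ((A.tangent P).restrict (F.map (tangentMap P))).deg =
      (A.restrict F).deg - finrank K F * (A.restrict P.submodule).deg := by
  let t := finBasis K (F.map (tangentMap P))
  choose f hf using fun i => tangentMapOn_surjective P F (t i)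
  have hd : (⟨lineVector P, hF (lineVector P).2⟩ : F) ≠ 0 := fun h =>
    lineVector_ne_zero P (Subtype.ext (congrArg (fun z : F => (z : E)) h))
  have hp1 := tangentMapOn_eq_zero P hF (one_ne_zero (α := K))
  simp only [one_smul] at hp1
  let x := consBasis hd hp1 hf
  have hx := coe_consBasis hd hp1 hf
  rw [finrank_eq_card_basis x, Fintype.card_fin, deg_eq _ t, deg_eq _ x, deg_eq _ (lineBasis P),
    degWith_eq, degWith_eq, degWith_eq]
  have h1 : ∀ v, Real.log ((A.restrict F).locNorm v x) =
      Real.log (((A.tangent P).restrict (F.map (tangentMap P))).locNorm v t) +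
        ((finrank K (F.map (tangentMap P)) + 1 : ℕ) : ℝ) *
          Real.log ((A.restrict P.submodule).locNorm v (lineBasis P)) := fun v => by
    rw [A.locNorm_tangent v hF t x hf hx, Real.log_mul (locNorm_pos _ v t).ne'
      (pow_ne_zero _ (locNorm_pos _ v _).ne'), Real.log_pow]
  have h2 : ∀ w : InfinitePlace K, w.mult * (Real.log ((A.restrict F).archGram w x) / 2) =
      w.mult * (Real.log (((A.tangent P).restrict (F.map (tangentMap P))).archGram w t) / 2) +
        ((finrank K (F.map (tangentMap P)) + 1 : ℕ) : ℝ) * (w.mult *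
          (Real.log ((A.restrict P.submodule).archGram w (lineBasis P)) / 2)) := fun w => by
    rw [hx, A.archGram_tangent w hF t hf, Real.log_mul (archGram_pos _ w t).ne'
      (pow_ne_zero _ (archGram_pos _ w _).ne'), Real.log_pow]
    ring
  simp only [h1, h2]
  rw [finsum_add_distrib, Finset.sum_add_distrib, ← mul_finsum, ← Finset.mul_sum]
  · ring
  · exact finite_support_log_locNorm _ t
  · refine (finite_support_log_locNorm (A.restrict P.submodule) (lineBasis P)).subset
      fun v hv h => hv ?_
    beta_reduce at h ⊢
    rw [h, mul_zero]

end AdelicSpace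

namespace AdelicSpace

open Module

section

variable {K E : Type*} [Field K] [NumberField K] [AddCommGroup E] [Module K E]
  [Module (𝓞 K) E] [IsScalarTower (𝓞 K) K E] (A : AdelicSpace K E)

theorem deg_restrict_top [FiniteDimensional K E] : (A.restrict ⊤).deg = A.deg := by
  let x := finBasis K E
  let i : E ≃ₗ[K] (⊤ : Submodule K E) := Submodule.topEquiv.symm
  have h1 : ∀ v, (A.restrict ⊤).locNorm v (x.map i) = A.locNorm v x := fun v => by
    obtain ⟨e, he⟩ := exists_isLocalBasis (v := v) A.isLattice x
    have he' : IsLocalBasis v (A.restrict ⊤).lattice (e.map i) := fun y => he y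
    rw [locNorm, locNorm, finNorm_eq he, finNorm_eq he', Basis.det_map]
    rfl
  have h2 : ∀ w, (A.restrict ⊤).archGram w (x.map i) = A.archGram w x := fun w => rfl
  rw [deg_eq _ x, deg_eq _ (x.map i), degWith_eq, degWith_eq]
  simp only [h1, h2]

theorem deg_restrict_congr [FiniteDimensional K E] {F F' : Submodule K E} (h : F = F') :
    (A.restrict F).deg = (A.restrict F').deg := by subst h; rfl

theorem map_tangentMap_top (P : ℙ K E) : (⊤ : Submodule K E).map (tangentMap P) = ⊤ := by
  rw [Submodule.map_top, LinearMap.range_eq_top]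
  exact tangentMap_surjective P

theorem finrank_map_tangentMap [FiniteDimensional K E] {P : ℙ K E} {F : Submodule K E}
    (hF : P.submodule ≤ F) :
    finrank K (F.map (tangentMap P)) + 1 = finrank K F := by
  let t := finBasis K (F.map (tangentMap P))
  choose f hf using fun i => tangentMapOn_surjective P F (t i)
  have hd : (⟨lineVector P, hF (lineVector P).2⟩ : F) ≠ 0 := fun h =>
    lineVector_ne_zero P (Subtype.ext (congrArg (fun z : F => (z : E)) h))
  have hp1 := tangentMapOn_eq_zero P hF (one_ne_zero (α := K))
  simp only [one_smul] at hp1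
  rw [finrank_eq_card_basis (consBasis hd hp1 hf), Fintype.card_fin]

/-- As `deg E = 0` for the standard space, this becomes `h(P) = - (n + 1) deg D`. -/
theorem height_eq [FiniteDimensional K E] (P : ℙ K E) :
    A.height P = A.deg - finrank K E * (A.restrict P.submodule).deg := by
  have h := A.deg_tangent_restrict (P := P) (F := ⊤) le_top
  rw [deg_restrict_congr _ (map_tangentMap_top P), deg_restrict_top, deg_restrict_top,
    finrank_top] at h
  exact h

end

end AdelicSpace

/-! ### An inequality for Gram determinants -/

section Minors

open scoped ComplexOrder

variable {𝕜 : Type*} [RCLike 𝕜]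

/-- If `M ≥ 1`, all eigenvalues of `M` are at least `1`. -/
theorem one_le_re_det_of_posSemidef {r : ℕ} {M : Matrix (Fin r) (Fin r) 𝕜}
    (h : (M - 1).PosSemidef) : 1 ≤ RCLike.re M.det := by
  have hM : M.IsHermitian := by
    have := h.isHermitian.add Matrix.isHermitian_one
    rwa [sub_add_cancel] at this
  rw [hM.det_eq_prod_eigenvalues, ← RCLike.ofReal_prod, RCLike.ofReal_re]
  refine Finset.one_le_prod fun i _ => ?_
  have h1 := h.re_dotProduct_nonneg (hM.eigenvectorBasis i)
  rw [Matrix.sub_mulVec, dotProduct_sub, map_sub, Matrix.one_mulVec] at h1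
  have h2 : RCLike.re (dotProduct (star ⇑(hM.eigenvectorBasis i)) ⇑(hM.eigenvectorBasis i)) =
      1 := by
    have h3 := hM.eigenvectorBasis.orthonormal.1 i
    have h4 := inner_self_eq_norm_sq (𝕜 := 𝕜) (hM.eigenvectorBasis i)
    rw [h3, EuclideanSpace.inner_eq_star_dotProduct, dotProduct_comm] at h4
    simpa using h4
  rw [h2, ← hM.eigenvalues_eq] at h1
  linarith

/-- The Gram determinant of the columns of `X` is at least the square of the absolute value of each
maximal minor of `X`. -/
theorem norm_det_submatrix_sq_le {m r : ℕ} (X : Matrix (Fin m) (Fin r) 𝕜) (τ : Fin r → Fin m) :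
    ‖(X.submatrix τ id).det‖ ^ 2 ≤ RCLike.re (X.conjTranspose * X).det := by
  classical
  by_cases hdet : (X.submatrix τ id).det = 0
  · rw [hdet, norm_zero, zero_pow two_ne_zero]
    exact (RCLike.nonneg_iff.1 (Matrix.posSemidef_conjTranspose_mul_self X).det_nonneg).1
  have hτ : Function.Injective τ := by
    intro i j hij
    by_contra hne
    exact hdet (Matrix.det_zero_of_row_eq hne (by ext k; simp [hij]))
  -- normalize the minor to the identity matrix; the other rows contribute `W`
  set B := X.submatrix τ id with hB
  let Z := X * B⁻¹
  have hBu : IsUnit B.det := IsUnit.mk0 _ hdet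
  have hZ : Z.submatrix τ id = 1 := by
    rw [← Matrix.mul_nonsing_inv B hBu]
    rfl
  have hZe : ∀ i j, Z (τ i) j = (1 : Matrix (Fin r) (Fin r) 𝕜) i j := fun i j => by
    rw [← hZ]; rfl
  have hX : X = Z * B := by
    rw [Matrix.mul_assoc, Matrix.nonsing_inv_mul B hBu, Matrix.mul_one]
  let W : Matrix (Fin m) (Fin r) 𝕜 := fun i j => if i ∈ Finset.univ.image τ then 0 else Z i j
  have hWe : ∀ i j, W i j = if i ∈ Finset.univ.image τ then 0 else Z i j := fun _ _ => rfl
  have hW : Z.conjTranspose * Z - 1 = W.conjTranspose * W := by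
    rw [sub_eq_iff_eq_add']
    ext a b
    rw [Matrix.add_apply, Matrix.mul_apply, Matrix.mul_apply,
      ← Finset.sum_filter_add_sum_filter_not _ (fun i => i ∈ Finset.univ.image τ)]
    congr 1
    · rw [Finset.filter_mem_eq_inter, Finset.univ_inter, Finset.sum_image hτ.injOn]
      simp [Matrix.conjTranspose_apply, hZe, Matrix.one_apply, eq_comm]
    · rw [Finset.sum_filter]
      refine Finset.sum_congr rfl fun i _ => ?_
      rw [Matrix.conjTranspose_apply, Matrix.conjTranspose_apply, hWe, hWe]
      by_cases hi : i ∈ Finset.univ.image τ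
      · rw [if_pos hi, if_pos hi, if_neg (not_not_intro hi), star_zero, zero_mul]
      · rw [if_neg hi, if_neg hi, if_pos hi]
  have h1 : 1 ≤ RCLike.re (Z.conjTranspose * Z).det := one_le_re_det_of_posSemidef (by
    rw [hW]; exact Matrix.posSemidef_conjTranspose_mul_self W)
  have h2 : (X.conjTranspose * X).det =
      ((‖B.det‖ ^ 2 : ℝ) : 𝕜) * (Z.conjTranspose * Z).det := by
    rw [hX, Matrix.conjTranspose_mul, Matrix.mul_assoc, ← Matrix.mul_assoc _ Z B, Matrix.det_mul,
      Matrix.det_mul, Matrix.det_conjTranspose, mul_left_comm, mul_comm, RCLike.star_def,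
      RCLike.conj_mul]
    push_cast
    rfl
  rw [h2, RCLike.re_ofReal_mul]
  exact le_mul_of_one_le_right (sq_nonneg _) h1

end Minors

/-! ### Heights of subspaces of the standard space -/

namespace AdelicSpace

open Module

section Standard

variable {K : Type*} [Field K] [NumberField K] {m : ℕ}

theorem mem_standard_lattice {x : Fin m → K} :
    x ∈ (standard K m).lattice ↔ ∀ i, ∃ a : 𝓞 K, algebraMap (𝓞 K) K a = x i := by
  simp [standard, Submodule.mem_pi]

theorem standard_inner (w : InfinitePlace K) (x y : Fin m → K) :
    ((standard K m).form w).inner (1 ⊗ₜ[K] x) (1 ⊗ₜ[K] y) =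
      ∑ i, star (algebraMap K w.Completion (x i)) * algebraMap K w.Completion (y i) := by
  let := completionRCLike w
  change inner w.Completion
    (WithLp.toLp 2 (TensorProduct.piScalarRight K w.Completion w.Completion (Fin m) (1 ⊗ₜ[K] x)) :
      EuclideanSpace w.Completion (Fin m))
    (WithLp.toLp 2 (TensorProduct.piScalarRight K w.Completion w.Completion (Fin m) (1 ⊗ₜ[K] y)))
      = _
  rw [EuclideanSpace.inner_eq_star_dotProduct]
  simp [dotProduct, Algebra.smul_def, mul_comm]

theorem archGram_standard (w : InfinitePlace K) {F : Submodule K (Fin m → K)} {r : ℕ}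
    (x : Fin r → F) : ((standard K m).restrict F).archGram w x =
      (letI := completionRCLike w
      RCLike.re ((Matrix.of fun i j => algebraMap K w.Completion ((x j : Fin m → K) i)).conjTranspose *
        (Matrix.of fun i j => algebraMap K w.Completion ((x j : Fin m → K) i))).det) := by
  let := completionRCLike w
  rw [archGram, gramDet]
  congr 2
  ext i j
  rw [Matrix.of_apply, restrict_inner, standard_inner]
  rfl

theorem deg_standard : (standard K m).deg = 0 := by
  let e := Pi.basisFun K (Fin m)
  have h1 : ∀ v, (standard K m).locNorm v e = 1 := fun v => by
    have he : IsLocalBasis v (standard K m).lattice e := by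
      refine isLocalBasis_of (fun i => le_localization ?_) fun y hy i => ?_
      · refine mem_standard_lattice.2 fun j => ?_
        rw [Pi.basisFun_apply]
        by_cases h : j = i
        · subst h; exact ⟨1, by simp⟩
        · exact ⟨0, by simp [h]⟩
      · obtain ⟨a, ha⟩ := mem_standard_lattice.1 hy i
        rw [Pi.basisFun_repr, ← ha]
        exact adicAbv_algebraMap_le_one v a
    rw [locNorm, finNorm_eq he, e.det_self, map_one]
  have h2 : ∀ w, (standard K m).archGram w e = 1 := fun w => by
    let := completionRCLike w
    have : (Matrix.of fun i j : Fin m => ((standard K m).form w).inner (1 ⊗ₜ[K] e i)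
        (1 ⊗ₜ[K] e j)) = 1 := by
      ext i j
      rw [Matrix.of_apply, standard_inner, Matrix.one_apply]
      simp [e, Pi.single_apply, eq_comm]
    rw [archGram, gramDet, this, Matrix.det_one, RCLike.one_re]
  rw [deg_eq _ e, degWith_eq]
  simp [h1, h2]

variable {F : Submodule K (Fin m → K)} {r : ℕ}

/-- The `v`-adic norm is at least the absolute value of each maximal minor. -/
theorem adicAbv_minor_le (v : HeightOneSpectrum (𝓞 K)) (x : Fin r → F) (τ : Fin r → Fin m) :
    HeightOneSpectrum.adicAbv K v
        (Matrix.of fun i j : Fin r => (x i : Fin m → K) (τ j)).det ≤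
      ((standard K m).restrict F).locNorm v x := by
  refine le_finNorm ((standard K m).restrict F).isLattice
    (Matrix.detRowAlternating.compLinearMap (LinearMap.funLeft K K τ ∘ₗ F.subtype))
    (fun y hy => ?_) x
  refine adicAbv_det_le_one v _ fun i j => ?_
  obtain ⟨a, ha⟩ := mem_standard_lattice.1 (hy i) (τ j)
  change HeightOneSpectrum.adicAbv K v ((y i : Fin m → K) (τ j)) ≤ 1
  have ha : algebraMap (𝓞 K) K a = (y i : Fin m → K) (τ j) := ha
  rw [← ha]
  exact adicAbv_algebraMap_le_one v a

theorem minor_sq_le_archGram (w : InfinitePlace K) (x : Fin r → F) (τ : Fin r → Fin m) :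
    w (Matrix.of fun i j : Fin r => (x i : Fin m → K) (τ j)).det ^ 2 ≤
      ((standard K m).restrict F).archGram w x := by
  let := completionRCLike w
  rw [archGram_standard]
  refine le_trans (le_of_eq ?_) (norm_det_submatrix_sq_le _ τ)
  rw [← norm_algebraMap_completion, RingHom.map_det, ← Matrix.det_transpose]
  rfl

/-- Every subspace of `K^m` has a basis in reduced form: some `r` coordinates of its members form
the identity matrix. -/
theorem exists_reduced_basis (F : Submodule K (Fin m → K)) :
    ∃ (τ : Fin (finrank K F) → Fin m) (x : Basis (Fin (finrank K F)) K F),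
      ∀ i j, (x i : Fin m → K) (τ j) = (1 : Matrix _ _ K) i j := by
  let φ : Fin m → Dual K F := fun l => LinearMap.proj l ∘ₗ F.subtype
  -- the coordinate functionals of `K^m` span the dual of `F`; a subset of them is a basis
  have hspan : Submodule.span K (Set.range φ) = ⊤ := by
    have h1 := LinearMap.range_eq_top.2 (LinearMap.dualMap_surjective_of_injective F.injective_subtype)
    rw [LinearMap.range_eq_map, ← (Pi.basisFun K (Fin m)).dualBasis.span_eq, Submodule.map_span,
      ← Set.range_comp] at h1
    rw [← h1]
    congr 2
    ext l y
    simp [φ]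
  have hr : finrank K (Submodule.span K (Set.range φ)) = finrank K F := by
    rw [hspan, finrank_top, Subspace.dual_finrank_eq]
  obtain ⟨g, hg, hgs, -⟩ := Submodule.exists_fun_fin_finrank_span_eq K (Set.range φ)
  choose τ hτ using hg
  replace hgs := hgs.trans hspan
  let σ : Fin (finrank K F) → Fin m := fun i => τ (Fin.cast hr.symm i)
  let L : F →ₗ[K] (Fin (finrank K F) → K) := LinearMap.funLeft K K σ ∘ₗ F.subtype
  have hL : Function.Injective L := by
    rw [← LinearMap.ker_eq_bot, LinearMap.ker_eq_bot']
    intro y hy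
    refine (Module.forall_dual_apply_eq_zero_iff K y).1 fun ψ => ?_
    have hψ : ψ ∈ Submodule.span K (Set.range g) := hgs ▸ Submodule.mem_top
    induction hψ using Submodule.span_induction with
    | mem ψ h =>
      obtain ⟨i, rfl⟩ := h
      rw [← hτ]
      exact congrFun hy (Fin.cast hr i)
    | zero => rfl
    | add _ _ _ _ h1 h2 => rw [LinearMap.add_apply, h1, h2, add_zero]
    | smul a _ _ h => rw [LinearMap.smul_apply, h, smul_zero]
  let e : F ≃ₗ[K] (Fin (finrank K F) → K) :=
    LinearEquiv.ofInjectiveOfFinrankEq L hL (by rw [finrank_fin_fun])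
  refine ⟨σ, Basis.ofEquivFun e, fun i j => ?_⟩
  have h := congrFun (e.apply_symm_apply (Pi.single i 1)) j
  rw [Matrix.one_apply]
  have h' : (Basis.ofEquivFun e i : Fin m → K) (σ j) = e (e.symm (Pi.single i 1)) j := by
    rw [Basis.coe_ofEquivFun]; rfl
  rw [h', h, Pi.single_apply]
  simp [eq_comm]

/-- With respect to a reduced basis, all finite norms and all Gram determinants are at least `1`. -/
theorem deg_standard_restrict_nonpos (F : Submodule K (Fin m → K)) :
    ((standard K m).restrict F).deg ≤ 0 := by
  obtain ⟨τ, x, hx⟩ := exists_reduced_basis F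
  have hd : (Matrix.of fun i j => (x i : Fin m → K) (τ j)).det = 1 := by
    rw [show (Matrix.of fun i j => (x i : Fin m → K) (τ j)) = 1 from Matrix.ext hx, Matrix.det_one]
  rw [deg_eq _ x, degWith_eq, neg_nonpos]
  refine add_nonneg (finsum_nonneg fun v => Real.log_nonneg ?_) (Finset.sum_nonneg fun w _ =>
    mul_nonneg (Nat.cast_nonneg _) (div_nonneg (Real.log_nonneg ?_) zero_le_two))
  · have := adicAbv_minor_le v x τ
    rwa [hd, map_one] at this
  · have := minor_sq_le_archGram w x τ
    rwa [hd, map_one, one_pow] at this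

/-- The entries of a reduced basis are maximal minors of it, so their heights are bounded by the
height of the subspace. -/
theorem logHeight₁_le {τ : Fin r → Fin m} {x : Basis (Fin r) K F}
    (hx : ∀ i j, (x i : Fin m → K) (τ j) = (1 : Matrix _ _ K) i j) (i : Fin r) (l : Fin m) :
    Height.logHeight₁ ((x i : Fin m → K) l) ≤ -((standard K m).restrict F).deg := by
  set a := (x i : Fin m → K) l with ha
  have hd : (Matrix.of fun i j => (x i : Fin m → K) (τ j)).det = 1 := by
    rw [show (Matrix.of fun i j => (x i : Fin m → K) (τ j)) = 1 from Matrix.ext hx, Matrix.det_one]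
  -- replacing the `i`-th selected coordinate by `l` gives the minor `a`
  have hda : (Matrix.of fun i' j => (x i' : Fin m → K) (Function.update τ i l j)).det = a := by
    have : (Matrix.of fun i' j => (x i' : Fin m → K) (Function.update τ i l j)) =
        (1 : Matrix (Fin r) (Fin r) K).updateCol i fun i' => (x i' : Fin m → K) l := by
      ext i' j
      rw [Matrix.of_apply, Matrix.updateCol_apply]
      split_ifs with h
      · rw [h, Function.update_self]
      · rw [Function.update_of_ne h, hx]
    rw [this, ← Matrix.cramer_apply, Matrix.cramer_one]
    rfl
  have h1 : ∀ v, Real.posLog (HeightOneSpectrum.adicAbv K v a) ≤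
      Real.log (((standard K m).restrict F).locNorm v x) := fun v => by
    have e1 := adicAbv_minor_le v x τ
    have e2 := adicAbv_minor_le v x (Function.update τ i l)
    rw [hd, map_one] at e1
    rw [hda] at e2
    rw [Real.posLog_eq_log_max_one (AbsoluteValue.nonneg _ _)]
    exact Real.log_le_log (by positivity) (max_le e1 e2)
  have h2 : ∀ w : InfinitePlace K, Real.posLog (w a) ≤
      Real.log (((standard K m).restrict F).archGram w x) / 2 := fun w => by
    have e1 := minor_sq_le_archGram w x τ
    have e2 := minor_sq_le_archGram w x (Function.update τ i l)
    rw [hd, map_one, one_pow] at e1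
    rw [hda] at e2
    rw [Real.posLog_eq_log_max_one (apply_nonneg w a), le_div_iff₀ zero_lt_two, mul_comm,
      ← Nat.cast_two, ← Real.log_pow]
    refine Real.log_le_log (by positivity) ?_
    rcases le_total 1 (w a) with h | h
    · rwa [max_eq_right h]
    · rwa [max_eq_left h, one_pow]
  rw [deg_eq _ x, degWith_eq, neg_neg, NumberField.logHeight₁_eq, add_comm]
  refine add_le_add ?_ (Finset.sum_le_sum fun w _ =>
    mul_le_mul_of_nonneg_left (h2 w) (Nat.cast_nonneg _))
  rw [← finsum_comp_equiv FinitePlace.equivHeightOneSpectrum.symm]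
  simp only [FinitePlace.equivHeightOneSpectrum_symm_apply, FinitePlace.norm_embedding]
  have hfin := finite_support_log_locNorm ((standard K m).restrict F) x
  refine finsum_le_finsum' (hfin.subset fun v hv h => hv ?_) hfin h1
  exact le_antisymm ((h1 v).trans h.le) Real.posLog_nonneg

/-- The Northcott property for subspaces. -/
theorem finite_le_deg (c : ℝ) :
    {F : Submodule K (Fin m → K) | c ≤ ((standard K m).restrict F).deg}.Finite := by
  let S : Set K := {a | Height.logHeight₁ a ≤ -c}
  have hS : S.Finite := NumberField.finite_setOfPred_logHeight₁_le K (-c)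
  let T : ∀ r : ℕ, Set (Fin r → Fin m → K) := fun r =>
    Set.univ.pi fun _ => Set.univ.pi fun _ => S
  have hT : ∀ r, (T r).Finite := fun r => Set.Finite.pi fun _ => Set.Finite.pi fun _ => hS
  refine ((Set.finite_Iic m).biUnion fun r _ =>
    (hT r).image fun X => Submodule.span K (Set.range X)).subset fun F hF => ?_
  obtain ⟨τ, x, hx⟩ := exists_reduced_basis F
  refine Set.mem_biUnion (x := finrank K F) ?_ ⟨fun i => x i, ?_, ?_⟩
  · simpa using F.finrank_le
  · refine fun i _ l _ => (logHeight₁_le hx i l).trans (neg_le_neg hF)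
  · have := congrArg (Submodule.map F.subtype) x.span_eq
    rwa [Submodule.map_span, ← Set.range_comp, Submodule.map_subtype_top] at this

end Standard

end AdelicSpace

/-! ### The last slope of the Newton polygon -/

namespace AdelicSpace

open Module

section Slope

variable {K E : Type*} [Field K] [NumberField K] [AddCommGroup E] [Module K E]
  [Module (𝓞 K) E] [IsScalarTower (𝓞 K) K E] [FiniteDimensional K E] (A : AdelicSpace K E)

/-- The last slope is the least slope of a quotient: if the points `(dim F, deg F)` lie below the
line of slope `μ` through `(dim E, deg E)` and some proper `F` lies on it, the last slope is `μ`. -/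
theorem slope_finrank_eq {μ : ℝ}
    (h : ∀ F : Submodule K E, F < ⊤ →
      μ * (finrank K E - finrank K F) ≤ A.deg - (A.restrict F).deg)
    {F₀ : Submodule K E} (hF₀ : F₀ < ⊤)
    (h₀ : μ * (finrank K E - finrank K F₀) = A.deg - (A.restrict F₀).deg) :
    A.slope (finrank K E) = μ := by
  have htop : ((finrank K E : ℝ), A.deg) ∈ A.newtonPolygon := by
    refine subset_convexHull ℝ _ ⟨⊤, ?_⟩
    rw [finrank_top, deg_restrict_top]
  have hle : ∀ p ∈ A.newtonPolygon, p.2 - μ * p.1 ≤ A.deg - μ * finrank K E := by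
    have hconv : Convex ℝ {p : ℝ × ℝ | p.2 - μ * p.1 ≤ A.deg - μ * finrank K E} :=
      convex_halfSpace_le ⟨fun p q => by simp only [Prod.fst_add, Prod.snd_add]; ring,
        fun c p => by simp only [Prod.smul_fst, Prod.smul_snd, smul_eq_mul]; ring⟩ _
    refine fun p hp => convexHull_min ?_ hconv hp
    rintro _ ⟨F, rfl⟩
    rcases lt_or_eq_of_le (le_top : F ≤ ⊤) with hF | rfl
    · have := h F hF
      simp only [Set.mem_ofPred_eq]
      linarith
    · simp [finrank_top, deg_restrict_top]
  have h1 : A.upperBoundary (finrank K E) = A.deg := by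
    refine IsGreatest.csSup_eq ⟨htop, fun y hy => ?_⟩
    have := hle _ hy
    simp only at this
    linarith
  have hlt : (finrank K F₀ : ℝ) + 1 ≤ finrank K E := by
    exact_mod_cast Submodule.finrank_lt hF₀.ne
  have h2 : A.upperBoundary (finrank K E - 1) = A.deg - μ := by
    refine IsGreatest.csSup_eq ⟨?_, fun y hy => ?_⟩
    · have hmem : ((finrank K F₀ : ℝ), (A.restrict F₀).deg) ∈ A.newtonPolygon :=
        subset_convexHull ℝ _ ⟨F₀, rfl⟩
      have hc : (0 : ℝ) < finrank K E - finrank K F₀ := by linarith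
      -- the point of the segment from `(dim F₀, deg F₀)` to `(dim E, deg E)` above `dim E - 1`
      have := (convex_convexHull ℝ _) hmem htop
        (a := 1 / ((finrank K E : ℝ) - finrank K F₀))
        (b := 1 - 1 / ((finrank K E : ℝ) - finrank K F₀)) (by positivity)
        (by rw [sub_nonneg, div_le_one hc]; linarith) (by ring)
      change ((finrank K E : ℝ) - 1, A.deg - μ) ∈ A.newtonPolygon
      convert! this using 1
      have e1 : (A.restrict F₀).deg = A.deg - μ * (finrank K E - finrank K F₀) := by
        rw [h₀]; ring
      rw [e1]
      ext
      · simp only [Prod.fst_add, Prod.smul_fst, smul_eq_mul]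
        field_simp
        ring
      · simp only [Prod.snd_add, Prod.smul_snd, smul_eq_mul]
        field_simp
        ring
    · have := hle _ hy
      simp only at this
      linarith
  rw [slope, h1, h2]
  ring

end Slope

/-- The last slope of the tangent space is the minimum of `(deg E - deg F) / codim F - deg D` over the
proper subspaces `F` containing `D`. -/
theorem slope_tangent_eq {K E : Type*} [Field K] [NumberField K] [AddCommGroup E] [Module K E]
    [Module (𝓞 K) E] [IsScalarTower (𝓞 K) K E] [FiniteDimensional K E] (A : AdelicSpace K E)
    (P : ℙ K E) {F₀ : Submodule K E} (hP₀ : P.submodule ≤ F₀) (hF₀ : F₀ < ⊤)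
    (hmin : ∀ F : Submodule K E, P.submodule ≤ F → F < ⊤ →
      (A.deg - (A.restrict F₀).deg) / finrank K (E ⧸ F₀) ≤
        (A.deg - (A.restrict F).deg) / finrank K (E ⧸ F)) :
    (A.tangent P).slope (finrank K (TangentSpace P)) =
      (A.deg - (A.restrict F₀).deg) / finrank K (E ⧸ F₀) - (A.restrict P.submodule).deg := by
  have hcodim : ∀ F : Submodule K E, F < ⊤ → (0 : ℝ) < finrank K (E ⧸ F) := fun F hF => by
    have h1 := Submodule.finrank_lt hF.ne
    have h2 := F.finrank_quotient_add_finrank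
    exact_mod_cast (by omega : 0 < finrank K (E ⧸ F))
  have hsub : ∀ F : Submodule K E, P.submodule ≤ F →
      (finrank K (TangentSpace P) : ℝ) - finrank K (F.map (tangentMap P)) =
        finrank K (E ⧸ F) := fun F hF => by
    have h1 := finrank_map_tangentMap hF
    have h2 := finrank_map_tangentMap (P := P) (F := ⊤) le_top
    rw [map_tangentMap_top, finrank_top, finrank_top] at h2
    have h3 := F.finrank_quotient_add_finrank
    rw [sub_eq_iff_eq_add]
    exact_mod_cast (by omega)
  have hdeg : ∀ F : Submodule K E, P.submodule ≤ F →
      (A.tangent P).deg - ((A.tangent P).restrict (F.map (tangentMap P))).deg =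
        A.deg - (A.restrict F).deg - finrank K (E ⧸ F) * (A.restrict P.submodule).deg :=
    fun F hF => by
      have h1 : (A.tangent P).deg = _ := A.height_eq P
      have h2 : (finrank K (E ⧸ F) : ℝ) + finrank K F = finrank K E := by
        exact_mod_cast F.finrank_quotient_add_finrank
      rw [h1, A.deg_tangent_restrict hF, ← h2]
      ring
  refine slope_finrank_eq (F₀ := F₀.map (tangentMap P)) _ (fun T hT => ?_) ?_ ?_
  · obtain ⟨F, hF, rfl⟩ : ∃ F : Submodule K E, P.submodule ≤ F ∧ F.map (tangentMap P) = T :=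
      ⟨T.comap (tangentMap P), fun y hy => by
        rw [Submodule.mem_comap, (tangentMap_eq_zero P).2 hy]; exact T.zero_mem,
        Submodule.map_comap_eq_of_surjective (tangentMap_surjective P) T⟩
    have hFt : F < ⊤ := lt_top_iff_ne_top.2 fun h => hT.ne (by rw [h, map_tangentMap_top])
    rw [hsub F hF, hdeg F hF]
    have := (le_div_iff₀ (hcodim F hFt)).1 (hmin F hF hFt)
    linarith
  · refine lt_top_iff_ne_top.2 fun h => ?_
    have := hsub F₀ hP₀
    rw [h, finrank_top, sub_self] at this
    exact (hcodim F₀ hF₀).ne this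
  · rw [hsub F₀ hP₀, hdeg F₀ hP₀, sub_mul, div_mul_cancel₀ _ (hcodim F₀ hF₀).ne']
    ring

end AdelicSpace
end Arakelov

/-! ### The freeness of a point of the projective space -/

open Module Arakelov.AdelicSpace in
theorem mainTheorem2 {K : Type*} [Field K] [NumberField K] (n : ℕ)
    (P : ℙ K (Fin (n + 1) → K))
    (hP : (Arakelov.AdelicSpace.standard K (n + 1)).height P ≠ 0) :
    (∃ m : ℝ,
      IsLeast
        {t : ℝ | ∃ F : Submodule K (Fin (n + 1) → K), P.submodule ≤ F ∧ F < ⊤ ∧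
          t = -n * ((Arakelov.AdelicSpace.standard K (n + 1)).restrict F).deg /
            (Module.finrank K ((Fin (n + 1) → K) ⧸ F) *
              (Arakelov.AdelicSpace.standard K (n + 1)).height P)} m ∧
      (Arakelov.AdelicSpace.standard K (n + 1)).freeness P = n / (n + 1) + m) ∧
    (n : ℝ) / (n + 1) ≤ (Arakelov.AdelicSpace.standard K (n + 1)).freeness P := by
  set A := standard K (n + 1) with hA
  have hdegA : A.deg = 0 := deg_standard
  have hnonpos : ∀ F, (A.restrict F).deg ≤ 0 := deg_standard_restrict_nonpos
  have hheight : A.height P = -((n + 1) * (A.restrict P.submodule).deg) := by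
    rw [height_eq, hdegA, finrank_fin_fun]
    push_cast
    ring
  set δ := -(A.restrict P.submodule).deg with hδ
  have hheight' : A.height P = (n + 1) * δ := by rw [hheight]; ring
  have hn1 : (0 : ℝ) < n + 1 := by positivity
  have hδ0 : 0 < δ := by
    refine lt_of_le_of_ne (neg_nonneg.2 (hnonpos _)) fun h => hP ?_
    rw [hheight', ← h, mul_zero]
  have hhpos : 0 < A.height P := hheight' ▸ mul_pos hn1 hδ0
  -- for `n = 0` the height vanishes, so that `D` is a proper subspace
  have hDtop : P.submodule < ⊤ := lt_top_iff_ne_top.2 fun h => hδ0.ne' (by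
    rw [hδ, deg_restrict_congr A h, deg_restrict_top, hdegA, neg_zero])
  have hcodim : ∀ F : Submodule K (Fin (n + 1) → K), F < ⊤ →
      (0 : ℝ) < finrank K ((Fin (n + 1) → K) ⧸ F) := fun F hF => by
    have h1 := Submodule.finrank_lt hF.ne
    have h2 := F.finrank_quotient_add_finrank
    exact_mod_cast (by omega : 0 < finrank K ((Fin (n + 1) → K) ⧸ F))
  let q : Submodule K (Fin (n + 1) → K) → ℝ := fun F =>
    (A.deg - (A.restrict F).deg) / finrank K ((Fin (n + 1) → K) ⧸ F)
  have hq0 : ∀ F, 0 ≤ q F := fun F =>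
    div_nonneg (by rw [hdegA, zero_sub]; exact neg_nonneg.2 (hnonpos F)) (Nat.cast_nonneg _)
  obtain ⟨F₀, ⟨hPF₀, hF₀, -⟩, hmin⟩ : ∃ F₀ ∈ {F | P.submodule ≤ F ∧ F < ⊤ ∧ q F ≤ q P.submodule},
      ∀ F ∈ {F | P.submodule ≤ F ∧ F < ⊤ ∧ q F ≤ q P.submodule}, q F₀ ≤ q F := by
    refine Set.exists_min_image _ q ?_ ⟨P.submodule, le_rfl, hDtop, le_rfl⟩
    refine (finite_le_deg (K := K) (m := n + 1) (-(q P.submodule * (n + 1)))).subset ?_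
    rintro F ⟨-, hF, hqF⟩
    have h1 := (div_le_iff₀ (hcodim F hF)).1 hqF
    have h2 : (finrank K ((Fin (n + 1) → K) ⧸ F) : ℝ) ≤ n + 1 := by
      have := F.finrank_quotient_le
      rw [finrank_fin_fun] at this
      exact_mod_cast this
    have h3 := mul_le_mul_of_nonneg_left h2 (hq0 P.submodule)
    rw [hdegA] at h1
    change -(q P.submodule * (n + 1)) ≤ (A.restrict F).deg
    linarith
  have hmin' : ∀ F : Submodule K (Fin (n + 1) → K), P.submodule ≤ F → F < ⊤ → q F₀ ≤ q F :=
    fun F hPF hF => by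
      rcases le_total (q F) (q P.submodule) with h | h
      · exact hmin F ⟨hPF, hF, h⟩
      · exact (hmin _ ⟨le_rfl, hDtop, le_rfl⟩).trans h
  have hrank : finrank K (Arakelov.TangentSpace P) = n := by
    have h := finrank_map_tangentMap (P := P) (F := ⊤) le_top
    rw [map_tangentMap_top, finrank_top, finrank_top, finrank_fin_fun] at h
    omega
  have hslope : (A.tangent P).slope n = q F₀ + δ := by
    have h := A.slope_tangent_eq P hPF₀ hF₀ hmin'
    rw [hrank] at h
    rw [h]
    ring
  have hfree : A.freeness P = n / (n + 1) + n * q F₀ / A.height P := by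
    have hpos : 0 < (A.tangent P).slope n := by
      rw [hslope]; exact add_pos_of_nonneg_of_pos (hq0 F₀) hδ0
    simp only [freeness, hrank]
    rw [if_pos hpos, hslope, hheight']
    field_simp
    ring
  have hval : ∀ F : Submodule K (Fin (n + 1) → K),
      -n * (A.restrict F).deg / (finrank K ((Fin (n + 1) → K) ⧸ F) * A.height P) =
        n * q F / A.height P := fun F => by
    simp only [q, hdegA]
    rw [← div_div, mul_div_assoc', zero_sub, neg_mul, mul_neg]
  refine ⟨⟨n * q F₀ / A.height P, ⟨⟨F₀, hPF₀, hF₀, (hval F₀).symm⟩, ?_⟩, hfree⟩, ?_⟩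
  · rintro _ ⟨F, hPF, hF, rfl⟩
    rw [hval F]
    exact div_le_div_of_nonneg_right
      (mul_le_mul_of_nonneg_left (hmin' F hPF hF) (Nat.cast_nonneg n)) hhpos.le
  · rw [hfree]
    exact le_add_of_nonneg_right
      (div_nonneg (mul_nonneg (Nat.cast_nonneg n) (hq0 F₀)) hhpos.le)
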